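/- Let $\Omega\subset\mathbb R^N$ ($N\in\{1,2,3\}$) be a bounded domain, $1<\alpha<2$, and write $E_{\alpha,\beta}(z)=\sum_{k\ge 0} z^k/\Gamma(\alpha k+\beta)$. There are constants $C_1,C_2>0$, depending only on $\alpha$, with $$|E_{\alpha,1}(-x)|\le \frac{C_1}{1+x},\qquad |E_{\alpha,\alpha+1}(-x)|\le \frac{C_2}{1+x}\qquad(x\ge 0),\tag{1}$$ and there is $T_*>0$, depending only on $\Omega$ and $\alpha$, such that the following holds for all $T_2>T_1\ge T_*$, for every pair of positive constants $C_1,C_2$ satisfying (1), and for every eigensystem $\{\lambda_n,\varphi_n\}_{n\ge1}$ of $-\Delta$ in $\Omega$ with homogeneous Dirichlet boundary condition (that is, $\{\varphi_n\}$ is an orthonormal basis of $L^2(\Omega)$ and each $\varphi_n\in H^1_0(\Omega)$ is a weak solution of $-\Delta\varphi_n=\lambda_n\varphi_n$). Put $$d:=\max\left(\frac{T_1^\alpha}{T_2^\alpha},\;1-\frac{1}{2C_1C_2|\Gamma(1-\alpha)|}\Big(1-\frac{T_1^\alpha}{T_2^\alpha}\Big)\right),$$ $$S_n(t)=E_{\alpha,1}(-\lambda_nt^\alpha),\qquad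 Q_n(t)=t^\alpha E_{\alpha,\alpha+1}(-\lambda_nt^\alpha),\qquad R_n=S_n(T_1)Q_n(T_2)-S_n(T_2)Q_n(T_1),$$ $\mathbb S(t)v=\sum_n S_n(t)(v,\varphi_n)\varphi_n$ and $\mathbb Q(t)v=\sum_n Q_n(t)(v,\varphi_n)\varphi_n$. Then $0<d<1$, and $S_n(T_1)$, $Q_n(T_2)$, $R_n$ are nonzero for all $n$. Let $p\in(0,1]$ and let $a,f,f^{(0)}$ belong to $D((-\Delta)^p)=\{v\in L^2(\Omega):\sum_n\lambda_n^{2p}(v,\varphi_n)^2<\infty\}$, where $(a,f)$ is an exact solution of the inverse problem with data $g_1,g_2\in L^2(\Omega)$, i.e. $$\mathbb S(T_1)a+\mathbb Q(T_1)f=g_1,\qquad \mathbb S(T_2)a+\mathbb Q(T_2)f=g_2 .$$ Then $$a=\sum_n\frac{Q_n(T_2)(g_1,\varphi_n)-Q_n(T_1)(g_2,\varphi_n)}{R_n}\varphi_n,\qquad f=\sum_n\frac{S_n(T_1)(g_2,\varphi_n)-S_n(T_2)(g_1,\varphi_n)}{R_n}\varphi_n .$$ Define alternately $$a^{(k)}=\sum_{n}\frac{(g_1,\varphi_n)-Q_n(T_1)(f^{(k)},\varphi_n)}{S_n(T_1)}\varphi_n\quad(k\ge0),\qquad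 f^{(k)}=\sum_{n}\frac{(g_2,\varphi_n)-S_n(T_2)(a^{(k-1)},\varphi_n)}{Q_n(T_2)}\varphi_n\quad(k\ge1).$$ All these series converge in $L^2(\Omega)$; the iterates satisfy $\mathbb S(T_1)a^{(k)}+\mathbb Q(T_1)f^{(k)}=g_1$ and $\mathbb S(T_2)a^{(k)}+\mathbb Q(T_2)f^{(k+1)}=g_2$ for all $k\ge 0$; and, with $\|\cdot\|$ the norm of $L^2(\Omega)$, for all $k\ge0$ $$\|a^{(k)}-a\|\le d^k\|a^{(0)}-a\|,\qquad \|f^{(k)}-f\|\le d^k\|f^{(0)}-f\|.$$ -/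

import Mathlib

open MeasureTheory Filter Topology
open scoped ContDiff

noncomputable section

namespace AltRecon

/-- The two-parameter Mittag-Leffler function `E_{α,β}` at a real argument. -/
def mittagLeffler (α β z : ℝ) : ℝ :=
  ∑' k : ℕ, z ^ k / Real.Gamma (α * k + β)

/-- `C` is an admissible constant in the decay estimate `|E_{α,β}(z)| ≤ C / (1 + |z|)` on the
closed negative half-line. -/
def IsDecayConst (α β C : ℝ) : Prop :=
  0 < C ∧ ∀ x : ℝ, 0 ≤ x → |mittagLeffler α β (-x)| ≤ C / (1 + x)

section Dirichlet

variable {N : ℕ}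

/-- The real Hilbert space `L²(Ω)`. -/
abbrev L2 (Ω : Set (EuclideanSpace ℝ (Fin N))) : Type :=
  Lp ℝ 2 (volume.restrict Ω)

/-- Test functions: elements of `C_c^∞(Ω)`. -/
structure IsTestFunction (Ω : Set (EuclideanSpace ℝ (Fin N)))
    (η : EuclideanSpace ℝ (Fin N) → ℝ) : Prop where
  smooth : ContDiff ℝ ∞ η
  compact : HasCompactSupport η
  support_subset : tsupport η ⊆ Ω

/-- `u` belongs to `H¹₀(Ω)`, the closure of `C_c^∞(Ω)` in `H¹(Ω)`, and `G` is its weak gradient. -/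
structure IsH10WithGradient (Ω : Set (EuclideanSpace ℝ (Fin N)))
    (u : EuclideanSpace ℝ (Fin N) → ℝ)
    (G : EuclideanSpace ℝ (Fin N) → EuclideanSpace ℝ (Fin N)) : Prop where
  memLp_fun : MemLp u 2 (volume.restrict Ω)
  memLp_grad : MemLp G 2 (volume.restrict Ω)
  approx : ∃ η : ℕ → EuclideanSpace ℝ (Fin N) → ℝ,
    (∀ j, IsTestFunction Ω (η j)) ∧
    Tendsto (fun j => eLpNorm (fun x => η j x - u x) 2 (volume.restrict Ω)) atTop (𝓝 0) ∧
    Tendsto (fun j => eLpNorm (fun x => gradient (η j) x - G x) 2 (volume.restrict Ω))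
      atTop (𝓝 0)

/-- `u` is a weak solution of `-Δu = l u` in `Ω`, `u = 0` on `∂Ω`. -/
def IsDirichletEigenfunction (Ω : Set (EuclideanSpace ℝ (Fin N))) (l : ℝ)
    (u : EuclideanSpace ℝ (Fin N) → ℝ) : Prop :=
  ∃ G : EuclideanSpace ℝ (Fin N) → EuclideanSpace ℝ (Fin N),
    IsH10WithGradient Ω u G ∧
    ∀ η : EuclideanSpace ℝ (Fin N) → ℝ, IsTestFunction Ω η →
      ∫ x in Ω, inner ℝ (G x) (gradient η x) = l * ∫ x in Ω, u x * η x

/-- `(lam n, φ n)` is an eigensystem of the negative Dirichlet Laplacian: the `φ n` form an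
orthonormal (Hilbert) basis of `L²(Ω)` and `φ n` is an eigenfunction for `lam n`. -/
def IsDirichletEigensystem (Ω : Set (EuclideanSpace ℝ (Fin N))) (lam : ℕ → ℝ)
    (φ : HilbertBasis ℕ ℝ (L2 Ω)) : Prop :=
  ∀ n, IsDirichletEigenfunction Ω (lam n) (φ n)

end Dirichlet

/-- `S_n(t) = E_{α,1}(-λ_n t^α)`, with `l = λ_n`. -/
def Scoef (α l t : ℝ) : ℝ := mittagLeffler α 1 (-(l * t ^ α))

/-- `Q_n(t) = t^α E_{α,α+1}(-λ_n t^α)`, with `l = λ_n`. -/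
def Qcoef (α l t : ℝ) : ℝ := t ^ α * mittagLeffler α (α + 1) (-(l * t ^ α))

/-- `R_n(T₁,T₂) = S_n(T₁) Q_n(T₂) - S_n(T₂) Q_n(T₁)`, with `l = λ_n`. -/
def Rcoef (α l T₁ T₂ : ℝ) : ℝ :=
  Scoef α l T₁ * Qcoef α l T₂ - Scoef α l T₂ * Qcoef α l T₁

/-- The contraction constant `d`. -/
def dConst (α T₁ T₂ C₁ C₂ : ℝ) : ℝ :=
  max (T₁ ^ α / T₂ ^ α)
    (1 - 1 / (2 * C₁ * C₂ * |Real.Gamma (1 - α)|) * (1 - T₁ ^ α / T₂ ^ α))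

section Iteration

variable {N : ℕ} {Ω : Set (EuclideanSpace ℝ (Fin N))}

/-- The space `D((-Δ)^p)`. -/
def domPow (lam : ℕ → ℝ) (φ : HilbertBasis ℕ ℝ (L2 Ω)) (p : ℝ) : Set (L2 Ω) :=
  {v | Summable fun n => lam n ^ (2 * p) * (inner ℝ v (φ n)) ^ 2}

/-- The operator `𝕊(t)`. -/
def Sop (α : ℝ) (lam : ℕ → ℝ) (φ : HilbertBasis ℕ ℝ (L2 Ω)) (t : ℝ) (v : L2 Ω) : L2 Ω :=
  ∑' n, (Scoef α (lam n) t * inner ℝ v (φ n)) • φ n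

/-- The operator `ℚ(t)`. -/
def Qop (α : ℝ) (lam : ℕ → ℝ) (φ : HilbertBasis ℕ ℝ (L2 Ω)) (t : ℝ) (v : L2 Ω) : L2 Ω :=
  ∑' n, (Qcoef α (lam n) t * inner ℝ v (φ n)) • φ n

/-- The solution `u(t) = 𝕊(t) a + ℚ(t) f` of the direct problem with `u(0) = a`, `∂ₜu(0) = 0` and
time-independent source `f`. -/
def directSol (α : ℝ) (lam : ℕ → ℝ) (φ : HilbertBasis ℕ ℝ (L2 Ω)) (a f : L2 Ω) (t : ℝ) : L2 Ω :=
  Sop α lam φ t a + Qop α lam φ t f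

/-- `(a, f)` solves the inverse problem with data `u(T₁) = g₁`, `u(T₂) = g₂`. -/
def IsExactSolution (α : ℝ) (lam : ℕ → ℝ) (φ : HilbertBasis ℕ ℝ (L2 Ω)) (T₁ T₂ : ℝ)
    (g₁ g₂ a f : L2 Ω) : Prop :=
  directSol α lam φ a f T₁ = g₁ ∧ directSol α lam φ a f T₂ = g₂

/-- Terms of the series for the solution `𝕊(T)⁻¹ (g - ℚ(T) h)` of the backward problem with
source `h` and data `g` at time `T`. -/
def backwardTerm (α : ℝ) (lam : ℕ → ℝ) (φ : HilbertBasis ℕ ℝ (L2 Ω)) (T : ℝ) (g h : L2 Ω)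
    (n : ℕ) : L2 Ω :=
  (1 / Scoef α (lam n) T * (inner ℝ g (φ n) - Qcoef α (lam n) T * inner ℝ h (φ n))) • φ n

/-- Terms of the series for the solution `ℚ(T)⁻¹ (g - 𝕊(T) b)` of the inverse source problem with
initial value `b` and data `g` at time `T`. -/
def sourceTerm (α : ℝ) (lam : ℕ → ℝ) (φ : HilbertBasis ℕ ℝ (L2 Ω)) (T : ℝ) (g b : L2 Ω)
    (n : ℕ) : L2 Ω :=
  (1 / Qcoef α (lam n) T * (inner ℝ g (φ n) - Scoef α (lam n) T * inner ℝ b (φ n))) • φ n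

/-- The source iterates: `f^{(0)} = f₀`, and `f^{(k+1)}` is the inverse source solution at `T₂` with
initial value `a^{(k)}`, the backward solution at `T₁` with source `f^{(k)}`. -/
def iterF (α : ℝ) (lam : ℕ → ℝ) (φ : HilbertBasis ℕ ℝ (L2 Ω)) (T₁ T₂ : ℝ) (g₁ g₂ f₀ : L2 Ω) :
    ℕ → L2 Ω
  | 0 => f₀
  | k + 1 => ∑' n, sourceTerm α lam φ T₂ g₂
      (∑' m, backwardTerm α lam φ T₁ g₁ (iterF α lam φ T₁ T₂ g₁ g₂ f₀ k) m) n

/-- The initial-value iterates: `a^{(k)}` is the backward solution at `T₁` with source `f^{(k)}`. -/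
def iterA (α : ℝ) (lam : ℕ → ℝ) (φ : HilbertBasis ℕ ℝ (L2 Ω)) (T₁ T₂ : ℝ) (g₁ g₂ f₀ : L2 Ω)
    (k : ℕ) : L2 Ω :=
  ∑' n, backwardTerm α lam φ T₁ g₁ (iterF α lam φ T₁ T₂ g₁ g₂ f₀ k) n

end Iteration

end AltRecon

end

/-! In the basis `φ` the problem splits into scalar 2×2 systems. One round of the iteration
multiplies the n-th coefficient of the error in f by ρ = S(T₂)Q(T₁)/(S(T₁)Q(T₂)), and the error in a
is -Q(T₁)/S(T₁) times that in f. So it suffices to bound |ρ| by d and Q(T₁)/S(T₁) by some constant,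
uniformly in n; Parseval does the rest (`iteration_converges`).

Since x E_{α,α+1}(-x) = 1 - E_{α,1}(-x), one has λQ = 1 - S, hence λR = S(T₁) - S(T₂) and 1 - ρ =
(S(T₂) - S(T₁)) / (-S(T₁) · λQ(T₂)). The decay estimates bound the denominator by C₁C₂/(λT₁^α). For
the numerator, E_{α,1}(-x) must be negative for large x and increase at least half as fast as its
leading term 1/(Γ(1-α)x) (`exists_mittagLeffler_one_neg_lower`). The factors λ cancel in the
quotient, which leaves the second entry of the maximum defining d (`coefBounds_of_le`).

The asymptotics come from a Hankel contour integral in the coordinate w = log s: Hankel's formula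
for 1/Γ (`hankelIntegral_exp`), summed over a geometric series, represents E_{α,1}(-x); the contour
is then collapsed to a ray, and the integrand split into leading term and remainder. Increments of
the remainder are estimated directly, so nothing is differentiated in x.

A threshold for T₁ valid for all n needs the eigenvalues bounded away from 0, which is Poincaré's
inequality (`IsDirichletEigenfunction.one_le_mul`). -/

namespace AltRecon

/-! ### Gamma integrals in the logarithmic variable and rotation of the line of integration. -/

section ExpIntegrals
open Set Complex

lemma integrable_exp_mul_exp_neg_mul_exp {b c : ℝ} (hb : 0 < b) (hc : 0 < c) :
    Integrable fun x : ℝ => Real.exp (b * x) * Real.exp (-(c * Real.exp x)) := by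
  have h := integrableOn_rpow_mul_exp_neg_mul_rpow (s := b - 1) (p := 1) (b := c)
    (by linarith) one_pos hc
  rw [← Real.range_exp, ← image_univ, integrableOn_image_iff_integrableOn_abs_deriv_smul
    MeasurableSet.univ (fun x _ => (Real.hasDerivAt_exp x).hasDerivWithinAt)
    Real.exp_injective.injOn, integrableOn_univ] at h
  refine h.congr (Eventually.of_forall fun x => ?_)
  simp only [smul_eq_mul, abs_of_pos (Real.exp_pos x), Real.rpow_one]
  rw [← Real.exp_mul, ← mul_assoc, ← Real.exp_add]
  ring_nf

lemma integral_exp_mul_exp_neg_exp {b : ℝ} (hb : 0 < b) :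
    ∫ x : ℝ, Real.exp (b * x) * Real.exp (-Real.exp x) = Real.Gamma b := by
  rw [Real.Gamma_eq_integral hb, ← Real.range_exp, ← image_univ,
    integral_image_eq_integral_abs_deriv_smul MeasurableSet.univ
    (fun x _ => (Real.hasDerivAt_exp x).hasDerivWithinAt) Real.exp_injective.injOn,
    setIntegral_univ]
  refine integral_congr_ae (Eventually.of_forall fun x => ?_)
  simp only [smul_eq_mul, abs_of_pos (Real.exp_pos x)]
  rw [← Real.exp_mul]
  simp only [← Real.exp_add]
  ring_nf

lemma tendsto_exp_mul_exp_neg_mul_exp_atTop (b : ℝ) {c : ℝ} (hc : 0 < c) :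
    Tendsto (fun x : ℝ => Real.exp (b * x) * Real.exp (-(c * Real.exp x))) atTop (𝓝 0) := by
  have h := (tendsto_rpow_mul_exp_neg_mul_atTop_nhds_zero b c hc).comp Real.tendsto_exp_atTop
  refine h.congr fun x => ?_
  simp only [Function.comp, neg_mul, ← Real.exp_mul]
  ring_nf

lemma tendsto_exp_mul_exp_neg_mul_exp_atBot {b c : ℝ} (hb : 0 < b) (hc : 0 ≤ c) :
    Tendsto (fun x : ℝ => Real.exp (b * x) * Real.exp (-(c * Real.exp x))) atBot (𝓝 0) := by
  have h : Tendsto (fun x : ℝ => Real.exp (b * x)) atBot (𝓝 0) :=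
    Real.tendsto_exp_atBot.comp (tendsto_id.const_mul_atBot hb)
  refine squeeze_zero (fun x => by positivity) (fun x => ?_) h
  refine mul_le_of_le_one_right (Real.exp_pos _).le (Real.exp_le_one_iff.2 ?_)
  have := Real.exp_pos x
  nlinarith

/-- Shift of the line of integration of a holomorphic function on a horizontal strip. -/
lemma integral_shift_horizontal {g : ℂ → ℂ} {ψ : ℝ} {B : ℝ → ℝ}
    (hg : Differentiable ℂ g) (h0 : Integrable fun x : ℝ => g x)
    (hψ : Integrable fun x : ℝ => g (x + ψ * I))
    (hB : ∀ x : ℝ, ∀ y ∈ uIoc 0 ψ, ‖g (x + y * I)‖ ≤ B x)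
    (htop : Tendsto B atTop (𝓝 0)) (hbot : Tendsto B atBot (𝓝 0)) :
    ∫ x : ℝ, g (x + ψ * I) = ∫ x : ℝ, g x := by
  have vert : ∀ {l : Filter ℝ} {m : ℕ → ℝ}, Tendsto B l (𝓝 0) → Tendsto m atTop l →
      Tendsto (fun n => ∫ y in (0 : ℝ)..ψ, g (m n + y * I)) atTop (𝓝 0) := by
    intro l m hl hm
    refine squeeze_zero_norm
      (fun n => intervalIntegral.norm_integral_le_of_norm_le_const (hB (m n))) ?_
    simpa using (hl.comp hm).mul_const |ψ - 0|
  have hn : Tendsto (fun n : ℕ => (n : ℝ)) atTop atTop := tendsto_natCast_atTop_atTop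
  have hn' : Tendsto (fun n : ℕ => -(n : ℝ)) atTop atBot := tendsto_neg_atTop_atBot.comp hn
  have e0 := intervalIntegral_tendsto_integral h0 hn' hn
  have e1 := intervalIntegral_tendsto_integral hψ hn' hn
  have v0 := vert hbot hn'
  have v1 := vert htop hn
  have key := ((e0.sub e1).add (v1.const_smul I)).sub (v0.const_smul I)
  have hz : ∀ n : ℕ, ((∫ x in (-(n : ℝ))..n, g x) - ∫ x in (-(n : ℝ))..n, g (x + ψ * I)) +
      (I • ∫ y in (0 : ℝ)..ψ, g ((n : ℝ) + y * I)) -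
      (I • ∫ y in (0 : ℝ)..ψ, g ((-(n : ℝ) : ℝ) + y * I)) = 0 := by
    intro n
    have := integral_boundary_rect_eq_zero_of_differentiableOn g (-(n : ℝ) : ℝ)
      ((n : ℝ) + ψ * I) hg.differentiableOn
    simpa using this
  have := tendsto_nhds_unique key (tendsto_const_nhds.congr fun n => (hz n).symm)
  simp only [smul_zero, add_zero, sub_zero] at this
  exact (sub_eq_zero.1 this).symm

lemma norm_exp_neg_exp_mul_exp (b x y : ℝ) :
    ‖cexp (b * (x + y * I)) * cexp (-cexp (x + y * I))‖ =
      Real.exp (b * x) * Real.exp (-(Real.cos y * Real.exp x)) := by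
  rw [norm_mul, norm_exp, norm_exp, neg_re, exp_re]
  simp [mul_comm]

/-- This is Euler's integral taken along the ray arg s = ψ, with s = e^w. On the strip between 0 and
ψ, cos y ≥ cos ψ > 0, which gives one majorant vanishing at both ends. -/
lemma integral_exp_mul_exp_neg_exp_rotate {b ψ : ℝ} (hb : 0 < b) (hψ : |ψ| < Real.pi / 2) :
    ∫ x : ℝ, cexp (b * (x + ψ * I)) * cexp (-cexp (x + ψ * I)) = Real.Gamma b := by
  have hcos : ∀ y : ℝ, |y| ≤ |ψ| → Real.cos ψ ≤ Real.cos y := fun y hy => by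
    rw [← Real.cos_abs y, ← Real.cos_abs ψ]
    exact Real.cos_le_cos_of_nonneg_of_le_pi (abs_nonneg _) (by linarith [Real.pi_pos]) hy
  have hc : 0 < Real.cos ψ := Real.cos_pos_of_mem_Ioo (abs_lt.1 hψ |>.imp (by intro h; linarith) id)
  have hint : ∀ y : ℝ, |y| ≤ |ψ| →
      Integrable fun x : ℝ => cexp (b * (x + y * I)) * cexp (-cexp (x + y * I)) := fun y hy => by
    refine (integrable_exp_mul_exp_neg_mul_exp hb (hc.trans_le (hcos y hy))).mono'
      (by fun_prop) (Eventually.of_forall fun x => (norm_exp_neg_exp_mul_exp b x y).le)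
  have h := integral_shift_horizontal (g := fun w => cexp (b * w) * cexp (-cexp w)) (ψ := ψ)
    (B := fun x => Real.exp (b * x) * Real.exp (-(Real.cos ψ * Real.exp x)))
    (by fun_prop) (by simpa using hint 0 (by simp)) (hint ψ le_rfl) ?_
    (tendsto_exp_mul_exp_neg_mul_exp_atTop b hc)
    (tendsto_exp_mul_exp_neg_mul_exp_atBot hb hc.le)
  · rw [h, ← integral_exp_mul_exp_neg_exp hb, ← integral_complex_ofReal]
    push_cast
    rfl
  · intro x y hy
    rw [norm_exp_neg_exp_mul_exp]
    have hy' : |y| ≤ |ψ| := by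
      have := abs_sub_left_of_mem_uIcc (uIoc_subset_uIcc hy)
      simpa using this
    gcongr
    exact hcos y hy'

lemma norm_exp_exp_mul_exp (b x y : ℝ) :
    ‖cexp (cexp (x + y * I)) * cexp (b * (x + y * I))‖ =
      Real.exp (b * x) * Real.exp (-((-Real.cos y) * Real.exp x)) := by
  rw [norm_mul, norm_exp, norm_exp, exp_re]
  simp [mul_comm]

lemma integrable_exp_exp_mul_exp_ray {b θ : ℝ} (hb : 0 < b) (hc : Real.cos θ < 0) :
    Integrable fun x : ℝ => cexp (cexp (x + θ * I)) * cexp (b * (x + θ * I)) :=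
  (integrable_exp_mul_exp_neg_mul_exp hb (neg_pos.2 hc)).mono'
      (by fun_prop) (Eventually.of_forall fun x => (norm_exp_exp_mul_exp b x θ).le)

/-- Since e^{x+iθ} = -e^{x+i(θ-π)}, the growing-looking integrand is the rotated Euler integrand at
angle θ - π ∈ (-π/2, 0); the phase e^{iπb} remains from e^{bw}. -/
lemma integral_exp_exp_mul_exp_ray {b θ : ℝ} (hb : 0 < b) (h1 : Real.pi / 2 < θ)
    (h2 : θ < Real.pi) :
    ∫ x : ℝ, cexp (cexp (x + θ * I)) * cexp (b * (x + θ * I)) =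
      Real.Gamma b * cexp (b * Real.pi * I) := by
  rw [← integral_exp_mul_exp_neg_exp_rotate (ψ := θ - Real.pi) hb
    (by rw [abs_lt]; constructor <;> linarith), ← integral_mul_const]
  refine integral_congr_ae (Eventually.of_forall fun x => ?_)
  have : cexp (x + θ * I) = - cexp (x + (θ - Real.pi : ℝ) * I) := by
    rw [← exp_add_pi_mul_I]
    push_cast
    ring_nf
  simp only [← this]
  simp only [← Complex.exp_add]
  push_cast
  ring_nf

end ExpIntegrals

/-! ### Hankel's formula for 1/Γ. -/

section Hankel
open Set Complex

/-- `Im` of the integral of `g` along the upper half of a Hankel contour, in the logarithmic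
coordinate: up the segment from `L` to `L + iθ`, then along the ray `L + iθ + [0, ∞)`. -/
noncomputable def hankelIntegral (θ L : ℝ) (g : ℂ → ℂ) : ℝ :=
  (∫ y in (0 : ℝ)..θ, g (L + y * I)).re + (∫ x in Ioi L, g (x + θ * I)).im

/-- Cauchy's theorem on the rectangle between abscissae L and M. Its bottom edge is on the real
axis, where g is real, so it drops out of the imaginary part; this is why half a contour is enough.
-/
lemma hankelIntegral_sub {θ : ℝ} {g : ℂ → ℂ} (hg : DifferentiableOn ℂ g (univ ×ℂ uIcc 0 θ))
    (hreal : ∀ x : ℝ, (g x).im = 0)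
    (hint : ∀ L, IntegrableOn (fun x : ℝ => g (x + θ * I)) (Ioi L)) (L M : ℝ) :
    hankelIntegral θ L g = hankelIntegral θ M g := by
  have h := integral_boundary_rect_eq_zero_of_differentiableOn g L (M + θ * I)
    (hg.mono (reProdIm_subset_iff'.2 (Or.inl ⟨subset_univ _, by simp⟩)))
  have hbot : (∫ x in L..M, g x).im = 0 := by
    have : ∀ x : ℝ, g x = ((g x).re : ℂ) := fun x => Complex.ext rfl (by simp [hreal x])
    rw [intervalIntegral.integral_congr (g := fun x : ℝ => ((g x).re : ℂ)) fun x _ => this x,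
      intervalIntegral.integral_ofReal, ofReal_im]
  have hI := intervalIntegral.integral_Ioi_sub_Ioi' (hint L) (hint M)
  have h' := congrArg Complex.im h
  have hI' := congrArg Complex.im hI
  simp at h' hI'
  rw [hbot] at h'
  unfold hankelIntegral
  linarith

/-- Let L → -∞: the vertical segment has fixed length and its integrand tends to 0, so only the full
ray survives. -/
lemma hankelIntegral_eq_im_integral {θ : ℝ} {g : ℂ → ℂ} {B : ℝ → ℝ}
    (hg : DifferentiableOn ℂ g (univ ×ℂ uIcc 0 θ))
    (hreal : ∀ x : ℝ, (g x).im = 0) (hint : Integrable fun x : ℝ => g (x + θ * I))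
    (hB : ∀ᶠ x : ℝ in atBot, ∀ y ∈ uIoc 0 θ, ‖g (x + y * I)‖ ≤ B x)
    (hbot : Tendsto B atBot (𝓝 0)) (L : ℝ) :
    hankelIntegral θ L g = (∫ x : ℝ, g (x + θ * I)).im := by
  have h1 : Tendsto (fun M : ℝ => (∫ y in (0 : ℝ)..θ, g (M + y * I)).re) atBot (𝓝 0) := by
    refine squeeze_zero_norm' (a := fun M => B M * |θ - 0|) ?_ (by simpa using hbot.mul_const _)
    filter_upwards [hB] with M hM
    exact (abs_re_le_norm _).trans (intervalIntegral.norm_integral_le_of_norm_le_const hM)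
  have h2 : Tendsto (fun M : ℝ => (∫ x in Ioi M, g (x + θ * I)).im) atBot
      (𝓝 (∫ x : ℝ, g (x + θ * I)).im) := by
    refine (continuous_im.tendsto _).comp ?_
    exact (aecover_Ioi tendsto_id).integral_tendsto_of_countably_generated hint
  have h3 := h1.add h2
  rw [zero_add] at h3
  refine tendsto_nhds_unique (tendsto_const_nhds.congr fun M => ?_) h3
  exact hankelIntegral_sub hg hreal (fun L => hint.integrableOn) L M

lemma integrableOn_exp_exp_mul_exp_ray (b : ℝ) {θ : ℝ} (hc : Real.cos θ < 0) (L : ℝ) :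
    IntegrableOn (fun x : ℝ => cexp (cexp (x + θ * I)) * cexp (b * (x + θ * I))) (Ioi L) := by
  have h := (integrable_exp_mul_exp_neg_mul_exp (b := max b 1) (c := -Real.cos θ)
    (by positivity) (neg_pos.2 hc)).const_mul (Real.exp ((b - max b 1) * L))
  refine h.integrableOn.mono' (by fun_prop) ?_
  filter_upwards [ae_restrict_mem measurableSet_Ioi] with x hx
  rw [norm_exp_exp_mul_exp, ← mul_assoc]
  refine mul_le_mul_of_nonneg_right ?_ (Real.exp_pos _).le
  rw [← Real.exp_add, Real.exp_le_exp]
  have : b ≤ max b 1 := le_max_left _ _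
  nlinarith [mem_Ioi.1 hx]

lemma im_exp_exp_mul_exp_ofReal (b x : ℝ) : (cexp (cexp x) * cexp (b * x)).im = 0 := by
  rw [← ofReal_mul, ← ofReal_exp, ← ofReal_exp, ← ofReal_exp, ← ofReal_mul, ofReal_im]

/-- For b > 0 the contour collapses to the ray and yields Γ(b) sin(πb), which is π/Γ(1-b) by
reflection. -/
lemma hankelIntegral_exp_of_pos {b θ : ℝ} (hb0 : 0 < b) (hb1 : b < 1) (h1 : Real.pi / 2 < θ)
    (h2 : θ < Real.pi) (L : ℝ) :
    hankelIntegral θ L (fun w => cexp (cexp w) * cexp (b * w)) =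
      Real.pi / Real.Gamma (1 - b) := by
  have hc : Real.cos θ < 0 := Real.cos_neg_of_pi_div_two_lt_of_lt h1 (by linarith)
  rw [hankelIntegral_eq_im_integral
    (B := fun x => Real.exp (b * x) * Real.exp (Real.exp x)) (by fun_prop)
    (im_exp_exp_mul_exp_ofReal b) (integrable_exp_exp_mul_exp_ray hb0 hc)
    (Eventually.of_forall fun x y _ => ?_) ?_,
    integral_exp_exp_mul_exp_ray hb0 h1 h2, im_ofReal_mul]
  · have hG := Real.Gamma_mul_Gamma_one_sub b
    have hpos := Real.Gamma_pos_of_pos (sub_pos.2 hb1)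
    have hs : 0 < Real.sin (Real.pi * b) := Real.sin_pos_of_pos_of_lt_pi
      (by positivity) (by nlinarith [Real.pi_pos])
    rw [eq_div_iff hpos.ne']
    rw [eq_div_iff hs.ne'] at hG
    have him : (cexp (b * Real.pi * I)).im = Real.sin (Real.pi * b) := by
      rw [exp_im]
      simp [mul_comm]
    rw [him]
    linarith
  · have h := Real.tendsto_exp_atBot.comp (tendsto_id.const_mul_atBot hb0)
    have h' := (Real.continuous_exp.tendsto 0).comp Real.tendsto_exp_atBot
    simpa using h.mul h'
  · rw [norm_exp_exp_mul_exp]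
    gcongr
    nlinarith [Real.cos_le_one y, Real.exp_pos x]

/-- Here the contour cannot be collapsed, so b → 0⁺ is taken with L fixed. Domination uses e^{bx} ≤
1 + e^x for 0 ≤ b ≤ 1. -/
lemma hankelIntegral_exp_zero {θ : ℝ} (h1 : Real.pi / 2 < θ) (h2 : θ < Real.pi) (L : ℝ) :
    hankelIntegral θ L (fun w => cexp (cexp w) * cexp ((0 : ℝ) * w)) =
      Real.pi / Real.Gamma (1 - 0) := by
  have hc : Real.cos θ < 0 := Real.cos_neg_of_pi_div_two_lt_of_lt h1 (by linarith)
  have hcont : ContinuousWithinAt (fun b : ℝ => hankelIntegral θ L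
      (fun w => cexp (cexp w) * cexp (b * w))) (Ioo 0 1) 0 := by
    unfold hankelIntegral
    refine ContinuousWithinAt.add ?_ ?_
    · refine continuous_re.continuousAt.comp_continuousWithinAt (ContinuousAt.continuousWithinAt ?_)
      refine Continuous.continuousAt ?_
      refine intervalIntegral.continuous_parametric_intervalIntegral_of_continuous' ?_ _ _
      fun_prop
    · refine continuous_im.continuousAt.comp_continuousWithinAt ?_
      refine continuousWithinAt_of_dominated (μ := volume.restrict (Ioi L))
        (F := fun (b : ℝ) (x : ℝ) => cexp (cexp (x + θ * I)) * cexp (b * (x + θ * I)))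
        (bound := fun x : ℝ =>
        ‖cexp (cexp (x + θ * I)) * cexp ((0 : ℝ) * (x + θ * I))‖ +
        ‖cexp (cexp (x + θ * I)) * cexp ((1 : ℝ) * (x + θ * I))‖)
        (Eventually.of_forall fun b => by fun_prop) ?_
        ((integrableOn_exp_exp_mul_exp_ray 0 hc L).norm.add
          (integrableOn_exp_exp_mul_exp_ray 1 hc L).norm)
        (Eventually.of_forall fun x => by fun_prop)
      filter_upwards [self_mem_nhdsWithin] with b hb
      refine Eventually.of_forall fun x => ?_
      rw [norm_exp_exp_mul_exp, norm_exp_exp_mul_exp, norm_exp_exp_mul_exp, ← add_mul]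
      gcongr
      rcases le_total x 0 with hx | hx
      · have : Real.exp (b * x) ≤ Real.exp (0 * x) :=
          Real.exp_le_exp.2 (by nlinarith [hb.1])
        linarith [Real.exp_pos (1 * x)]
      · have : Real.exp (b * x) ≤ Real.exp (1 * x) :=
          Real.exp_le_exp.2 (by nlinarith [hb.2])
        linarith [Real.exp_pos (0 * x)]
  have hG : ContinuousWithinAt (fun b : ℝ => Real.pi / Real.Gamma (1 - b)) (Ioo 0 1) 0 := by
    refine ContinuousAt.continuousWithinAt ?_
    have : ContinuousAt Real.Gamma (1 - 0) :=
      (Real.differentiableAt_Gamma fun m => by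
        have : (0 : ℝ) ≤ m := m.cast_nonneg
        linarith).continuousAt
    exact continuousAt_const.div (this.comp (by fun_prop)) (by simp)
  have hne : (𝓝[Ioo (0 : ℝ) 1] 0).NeBot := by
    rw [← mem_closure_iff_nhdsWithin_neBot, closure_Ioo (by norm_num)]
    simp
  refine tendsto_nhds_unique hcont.tendsto (hG.tendsto.congr' ?_)
  filter_upwards [self_mem_nhdsWithin] with b hb
  exact (hankelIntegral_exp_of_pos hb.1 hb.2 h1 h2 L).symm

/-- Integrate the derivative of e^{e^w} e^{cw} along the contour: the primitive vanishes at infinity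
and is real at L. The resulting recurrence mirrors Γ(s+1) = sΓ(s). -/
lemma hankelIntegral_exp_add_one (c : ℝ) {θ : ℝ} (hc : Real.cos θ < 0) (L : ℝ) :
    hankelIntegral θ L (fun w => cexp (cexp w) * cexp ((c + 1 : ℝ) * w)) =
      -c * hankelIntegral θ L (fun w => cexp (cexp w) * cexp (c * w)) := by
  have hd : ∀ w : ℂ, HasDerivAt (fun w : ℂ => cexp (cexp w) * cexp (c * w))
      (cexp (cexp w) * cexp ((c + 1 : ℝ) * w) + c * (cexp (cexp w) * cexp (c * w))) w := by
    intro w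
    have h1 := (Complex.hasDerivAt_exp w).cexp
    have h2 := ((hasDerivAt_id w).const_mul (c : ℂ)).cexp
    refine (h1.mul h2).congr_deriv ?_
    push_cast
    rw [add_mul, Complex.exp_add]
    simp
    ring
  set G : ℂ → ℂ := fun w => cexp (cexp w) * cexp (c * w) with hGdef
  set E : ℂ → ℂ := fun w => cexp (cexp w) * cexp ((c + 1 : ℝ) * w) with hEdef
  have hGc : Continuous G := by fun_prop
  have hEc : Continuous E := by fun_prop
  have hv : (∫ y in (0 : ℝ)..θ, (E (L + y * I) + c * G (L + y * I))) =
      -I * (G (L + θ * I) - G L) := by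
    have hd' : ∀ y : ℝ, HasDerivAt (fun y : ℝ => G (L + y * I) * (-I))
        (E (L + y * I) + c * G (L + y * I)) y := by
      intro y
      have hl : HasDerivAt (fun y : ℝ => (L + y * I : ℂ)) I y := by
        simpa using ((hasDerivAt_id y).ofReal_comp.mul_const I).const_add (L : ℂ)
      refine (((hd (L + y * I)).comp y hl).mul_const (-I)).congr_deriv ?_
      rw [mul_assoc, mul_neg, I_mul_I, neg_neg, mul_one]
    rw [intervalIntegral.integral_eq_sub_of_hasDerivAt (fun y _ => hd' y)
      (Continuous.intervalIntegrable (by fun_prop) _ _)]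
    simp
    ring
  have hEi : IntegrableOn (fun x : ℝ => E (x + θ * I)) (Ioi L) :=
    integrableOn_exp_exp_mul_exp_ray (c + 1) hc L
  have hGi : IntegrableOn (fun x : ℝ => G (x + θ * I)) (Ioi L) :=
    integrableOn_exp_exp_mul_exp_ray c hc L
  have hh : (∫ x in Ioi L, (E (x + θ * I) + c * G (x + θ * I))) = - G (L + θ * I) := by
    have hd' : ∀ x : ℝ, HasDerivAt (fun x : ℝ => G (x + θ * I))
        (E (x + θ * I) + c * G (x + θ * I)) x := by
      intro x
      have hl : HasDerivAt (fun x : ℝ => (x + θ * I : ℂ)) 1 x := by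
        simpa using (hasDerivAt_id x).ofReal_comp.add_const (θ * I : ℂ)
      exact ((hd (x + θ * I)).comp x hl).congr_deriv (mul_one _)
    rw [integral_Ioi_of_hasDerivAt_of_tendsto' (m := 0) (fun x _ => hd' x)
      (hEi.add (hGi.const_mul _)) ?_, zero_sub]
    rw [tendsto_zero_iff_norm_tendsto_zero]
    refine (tendsto_exp_mul_exp_neg_mul_exp_atTop c (neg_pos.2 hc)).congr fun x => ?_
    rw [hGdef]
    exact (norm_exp_exp_mul_exp c x θ).symm
  rw [intervalIntegral.integral_add (Continuous.intervalIntegrable (by fun_prop) _ _)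
    (Continuous.intervalIntegrable (by fun_prop) _ _), intervalIntegral.integral_const_mul] at hv
  rw [integral_add hEi (hGi.const_mul _), integral_const_mul] at hh
  have hv' := congrArg re hv
  have hh' := congrArg im hh
  have hr : (G L).im = 0 := im_exp_exp_mul_exp_ofReal c L
  simp [hr] at hv' hh'
  unfold hankelIntegral
  linarith

/-- Hankel's formula for the reciprocal Gamma function. -/
theorem hankelIntegral_exp {b θ : ℝ} (hb : b < 1) (h1 : Real.pi / 2 < θ) (h2 : θ < Real.pi)
    (L : ℝ) : hankelIntegral θ L (fun w => cexp (cexp w) * cexp (b * w)) =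
      Real.pi / Real.Gamma (1 - b) := by
  have hc : Real.cos θ < 0 := Real.cos_neg_of_pi_div_two_lt_of_lt h1 (by linarith)
  -- Induction on an integer above -b: the recurrence descends in unit steps from the base strip 0 ≤
  -- b < 1.
  obtain ⟨n, hn⟩ := exists_nat_ge (-b)
  induction n generalizing b with
  | zero =>
    rcases eq_or_lt_of_le (show 0 ≤ b by simpa using hn) with rfl | hb0
    · exact hankelIntegral_exp_zero h1 h2 L
    · exact hankelIntegral_exp_of_pos hb0 hb h1 h2 L
  | succ n ih =>
    by_cases hbn : -b ≤ n
    · exact ih hb hbn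
    have hb0 : b < 0 := by
      have : (0 : ℝ) ≤ n := n.cast_nonneg
      linarith
    have h := ih (b := b + 1) (by linarith) (by push_cast at hn; linarith)
    rw [hankelIntegral_exp_add_one b hc, show 1 - (b + 1) = -b by ring] at h
    have hG := Real.Gamma_add_one (s := -b) (by linarith)
    have hpos := Real.Gamma_pos_of_pos (s := -b) (by linarith)
    rw [show (1 : ℝ) - b = -b + 1 by ring, hG, eq_div_iff (by nlinarith)]
    rw [eq_div_iff hpos.ne'] at h
    linarith

end Hankel

/-! ### Contour representation of E_{α,1}(-x). -/

section MittagLeffler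
open Set Complex

/-- The Hankel integrand of `E_{α,1}(-x)` in the logarithmic coordinate. -/
noncomputable def mlIntegrand (α x : ℝ) (w : ℂ) : ℂ :=
  cexp (cexp w) * (cexp (α * w) / (cexp (α * w) + x))

lemma norm_exp_ofReal_mul (α u y : ℝ) : ‖cexp (α * (u + y * I))‖ = Real.exp (α * u) := by
  rw [norm_exp]
  simp

/-- The argument of e^{αw} stays in [0, π), so it never meets -x; collapsing the contour therefore
crosses no pole. -/
lemma exp_add_ofReal_ne_zero {α θ x y : ℝ} (hα : 0 < α) (hαθ : α * θ < Real.pi) (hx : 0 < x)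
    (hy : y ∈ Icc 0 θ) (u : ℝ) : cexp (α * (u + y * I)) + x ≠ 0 := by
  intro h
  rcases eq_or_lt_of_le hy.1 with rfl | hy0
  · have hre := congrArg re h
    rw [add_re, exp_re] at hre
    simp at hre
    linarith [Real.exp_pos (α * u)]
  · have him := congrArg im h
    rw [add_im, exp_im] at him
    simp at him
    exact (Real.sin_pos_of_pos_of_lt_pi (by positivity) (by nlinarith [hy.2])).ne' him

/-- Rotating by e^{-iαθ} makes the exponential real, so the imaginary part comes from x alone. The
bound is uniform along the ray. -/
lemma mul_sin_le_norm_exp_add_ofReal (α θ u x : ℝ) :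
    x * Real.sin (α * θ) ≤ ‖cexp (α * (u + θ * I)) + x‖ := by
  have h : ‖cexp (α * (u + θ * I)) + x‖ =
      ‖(cexp (α * (u + θ * I)) + x) * cexp ((-(α * θ) : ℝ) * I)‖ := by
    rw [norm_mul, norm_exp_ofReal_mul_I, mul_one]
  have h2 : (cexp (α * (u + θ * I)) + x) * cexp ((-(α * θ) : ℝ) * I) =
      (Real.exp (α * u) : ℝ) + x * cexp ((-(α * θ) : ℝ) * I) := by
    rw [add_mul, ← Complex.exp_add, ofReal_exp]
    push_cast
    ring_nf
  rw [h, h2]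
  refine le_trans (le_of_eq ?_) ((neg_le_abs _).trans (abs_im_le_norm _))
  rw [add_im, im_ofReal_mul, exp_ofReal_mul_I_im, ofReal_im, Real.sin_neg]
  ring

/-- Geometric expansion of 1/(1 + x e^{-αw}), valid where |e^{αw}| > x. -/
lemma hasSum_mlIntegrand (α : ℝ) {x u y : ℝ} (hx : 0 ≤ x) (hq : x * Real.exp (-(α * u)) < 1) :
    HasSum (fun k : ℕ => (((-x) ^ k : ℝ) : ℂ) *
        (cexp (cexp (u + y * I)) * cexp ((-(α * k) : ℝ) * (u + y * I))))
      (mlIntegrand α x (u + y * I)) := by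
  set w : ℂ := u + y * I with hw
  have hn : ‖-(x : ℂ) * cexp (-(α * w))‖ < 1 := by
    rw [norm_mul, norm_neg, norm_real, Real.norm_of_nonneg hx, norm_exp]
    simpa [hw] using hq
  have h := (hasSum_geometric_of_norm_lt_one hn).mul_left (cexp (cexp w))
  have hne : (1 : ℂ) - -(x : ℂ) * cexp (-(α * w)) ≠ 0 := by
    intro h0
    rw [sub_eq_zero] at h0
    rw [← h0] at hn
    simp at hn
  have hval : mlIntegrand α x w =
      cexp (cexp w) * (1 - -(x : ℂ) * cexp (-(α * w)))⁻¹ := by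
    unfold mlIntegrand
    have he : cexp (α * w) + x = cexp (α * w) * (1 - -(x : ℂ) * cexp (-(α * w))) := by
      rw [mul_sub, mul_left_comm, ← Complex.exp_add]
      simp
    rw [he, ← div_div, div_self (Complex.exp_ne_zero _), one_div]
  rw [hval]
  refine h.congr_fun fun k => ?_
  rw [mul_pow, ← Complex.exp_nat_mul]
  push_cast
  ring_nf

lemma norm_mlIntegrand_term (α x u y : ℝ) (hx : 0 ≤ x) (k : ℕ) :
    ‖(((-x) ^ k : ℝ) : ℂ) *
        (cexp (cexp (u + y * I)) * cexp ((-(α * k) : ℝ) * (u + y * I)))‖ =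
      (x * Real.exp (-(α * u))) ^ k * ‖cexp (cexp (u + y * I))‖ := by
  rw [norm_mul, norm_mul, norm_exp_ofReal_mul, norm_real, norm_pow, norm_neg,
    Real.norm_of_nonneg hx, mul_pow, ← Real.exp_nat_mul]
  ring_nf

lemma hankelIntegral_const_mul (θ L c : ℝ) (g : ℂ → ℂ) :
    hankelIntegral θ L (fun w => c * g w) = c * hankelIntegral θ L g := by
  unfold hankelIntegral
  rw [intervalIntegral.integral_const_mul, integral_const_mul, re_ofReal_mul, im_ofReal_mul]
  ring

/-- Termwise integration of the geometric series, with Hankel's formula at b = -αk producing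
1/Γ(αk+1). L must be large enough that the whole contour lies in the region of convergence. -/
lemma hasSum_mittagLeffler_hankelIntegral {α θ x L : ℝ} (hα : 0 < α)
    (h1 : Real.pi / 2 < θ) (h2 : θ < Real.pi) (hx : 0 ≤ x)
    (hq : x * Real.exp (-(α * L)) < 1) :
    HasSum (fun k : ℕ => (-x) ^ k / Real.Gamma (α * k + 1))
      (hankelIntegral θ L (mlIntegrand α x) / Real.pi) := by
  have hc : Real.cos θ < 0 := Real.cos_neg_of_pi_div_two_lt_of_lt h1 (by linarith)
  set q := x * Real.exp (-(α * L)) with hqdef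
  have hq0 : 0 ≤ q := by positivity
  have hgeom := summable_geometric_of_lt_one hq0 hq
  have hv : HasSum (fun k : ℕ => ∫ y in (0 : ℝ)..θ, (((-x) ^ k : ℝ) : ℂ) *
      (cexp (cexp (L + y * I)) * cexp ((-(α * k) : ℝ) * (L + y * I))))
      (∫ y in (0 : ℝ)..θ, mlIntegrand α x (L + y * I)) := by
    refine intervalIntegral.hasSum_integral_of_dominated_convergence
      (fun k y => q ^ k * ‖cexp (cexp (L + y * I))‖)
      (fun k => Continuous.aestronglyMeasurable (by fun_prop))
      (fun k => Eventually.of_forall fun y _ => (norm_mlIntegrand_term α x L y hx k).le)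
      (Eventually.of_forall fun y _ => hgeom.mul_right _) ?_
      (Eventually.of_forall fun y _ => hasSum_mlIntegrand α hx hq)
    simp only [tsum_mul_right]
    exact Continuous.intervalIntegrable (by fun_prop) _ _
  have hh : HasSum (fun k : ℕ => ∫ u in Ioi L, (((-x) ^ k : ℝ) : ℂ) *
      (cexp (cexp (u + θ * I)) * cexp ((-(α * k) : ℝ) * (u + θ * I))))
      (∫ u in Ioi L, mlIntegrand α x (u + θ * I)) := by
    have hqu : ∀ u ∈ Ioi L, x * Real.exp (-(α * u)) ≤ q := fun u hu => by
      rw [hqdef]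
      gcongr
      exact (mem_Ioi.1 hu).le
    refine hasSum_integral_of_dominated_convergence
      (fun k u => q ^ k * ‖cexp (cexp (u + θ * I))‖)
      (fun k => Continuous.aestronglyMeasurable (by fun_prop)) (fun k => ?_)
      (Eventually.of_forall fun y => hgeom.mul_right _) ?_ ?_
    · filter_upwards [ae_restrict_mem measurableSet_Ioi] with u hu
      rw [norm_mlIntegrand_term α x u θ hx k]
      gcongr
      exact hqu u hu
    · simp only [tsum_mul_right]
      have := (integrableOn_exp_exp_mul_exp_ray 0 hc L).norm.const_mul (∑' k : ℕ, q ^ k)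
      simpa using this
    · filter_upwards [ae_restrict_mem measurableSet_Ioi] with u hu
      exact hasSum_mlIntegrand α hx ((hqu u hu).trans_lt hq)
  have h := ((reCLM.hasSum hv).add (imCLM.hasSum hh)).div_const Real.pi
  refine h.congr_fun fun k => ?_
  have hk : -(α * k) < 1 := by
    have : 0 ≤ α * k := by positivity
    linarith
  have e := hankelIntegral_const_mul θ L ((-x) ^ k)
    (fun w => cexp (cexp w) * cexp ((-(α * k) : ℝ) * w))
  rw [hankelIntegral_exp hk h1 h2 L, show 1 - -(α * k) = α * k + 1 by ring] at e
  simp only [reCLM_apply, imCLM_apply]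
  unfold hankelIntegral at e
  rw [e]
  field_simp

lemma norm_mlIntegrand_le {α θ x : ℝ} (hs : 0 < Real.sin (α * θ)) (hx : 0 < x) (u : ℝ) :
    ‖mlIntegrand α x (u + θ * I)‖ ≤
      ‖cexp (cexp (u + θ * I)) * cexp (α * (u + θ * I))‖ * (x * Real.sin (α * θ))⁻¹ := by
  unfold mlIntegrand
  rw [← mul_div_assoc, norm_div, div_eq_mul_inv]
  gcongr
  exact mul_sin_le_norm_exp_add_ofReal α θ u x

lemma continuous_mlIntegrand_ray {α θ x : ℝ} (hα : 0 < α) (hθ : 0 ≤ θ) (hαθ : α * θ < Real.pi)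
    (hx : 0 < x) : Continuous fun u : ℝ => mlIntegrand α x (u + θ * I) := by
  unfold mlIntegrand
  refine Continuous.mul (by fun_prop) (Continuous.div (by fun_prop) (by fun_prop) fun u => ?_)
  exact exp_add_ofReal_ne_zero hα hαθ hx ⟨hθ, le_rfl⟩ u

/-- Integral representation of `E_{α,1}` on the negative half-line. -/
theorem mittagLeffler_one_neg_eq_integral {α θ x : ℝ} (hα : 0 < α) (h1 : Real.pi / 2 < θ)
    (h2 : θ < Real.pi) (hαθ : α * θ < Real.pi) (hx : 0 < x) :
    mittagLeffler α 1 (-x) = (∫ u : ℝ, mlIntegrand α x (u + θ * I)).im / Real.pi := by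
  have hc : Real.cos θ < 0 := Real.cos_neg_of_pi_div_two_lt_of_lt h1 (by linarith)
  have hθ : 0 < θ := lt_trans (by positivity) h1
  have hs : 0 < Real.sin (α * θ) := Real.sin_pos_of_pos_of_lt_pi (by positivity) hαθ
  obtain ⟨L, hL⟩ : ∃ L : ℝ, x * Real.exp (-(α * L)) < 1 := by
    -- Chosen so that e^{αL} = 2x, giving geometric ratio 1/2.
    refine ⟨Real.log (2 * x) / α, ?_⟩
    rw [mul_div_cancel₀ _ hα.ne', Real.exp_neg, Real.exp_log (by positivity), mul_inv,
      mul_left_comm, mul_inv_cancel₀ hx.ne']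
    norm_num
  rw [mittagLeffler, (hasSum_mittagLeffler_hankelIntegral hα h1 h2 hx.le hL).tsum_eq,
    hankelIntegral_eq_im_integral
      (B := fun u => Real.exp (Real.exp u) * (Real.exp (α * u) / (x / 2)))]
  · intro w hw
    have hne : cexp (α * w) + x ≠ 0 := by
      have := exp_add_ofReal_ne_zero hα hαθ hx (y := w.im)
        (by simpa [uIcc_of_le hθ.le] using hw.2) w.re
      rwa [re_add_im] at this
    refine DifferentiableAt.differentiableWithinAt ?_
    unfold mlIntegrand
    exact DifferentiableAt.mul (by fun_prop) (DifferentiableAt.div (by fun_prop) (by fun_prop) hne)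
  · intro u
    unfold mlIntegrand
    rw [← ofReal_mul, ← ofReal_exp, ← ofReal_exp, ← ofReal_exp, ← ofReal_add, ← ofReal_div,
      ← ofReal_mul, ofReal_im]
  · exact ((integrable_exp_exp_mul_exp_ray hα hc).norm.mul_const _).mono'
      (continuous_mlIntegrand_ray hα hθ.le hαθ hx).aestronglyMeasurable
      (Eventually.of_forall fun u => norm_mlIntegrand_le hs hx u)
  · have ht : Tendsto (fun u : ℝ => Real.exp (α * u)) atBot (𝓝 0) :=
      Real.tendsto_exp_atBot.comp (tendsto_id.const_mul_atBot hα)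
    -- Far to the left |e^{αw}| < x/2, so the denominator has modulus at least x/2.
    filter_upwards [ht.eventually (gt_mem_nhds (half_pos hx))] with u hu y _
    unfold mlIntegrand
    rw [norm_mul, norm_div, norm_exp_ofReal_mul]
    have hn : ‖cexp (cexp (u + y * I))‖ ≤ Real.exp (Real.exp u) := by
      rw [norm_exp, exp_re]
      simp only [add_re, ofReal_re, mul_re, I_re, mul_zero, ofReal_im, I_im, mul_one, sub_self,
        add_zero, add_im, mul_im, zero_add]
      gcongr
      nlinarith [Real.cos_le_one y, Real.exp_pos u]
    have hd : x / 2 ≤ ‖cexp (α * (u + y * I)) + x‖ := by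
      have := norm_sub_norm_le (x : ℂ) (-cexp (α * (u + y * I)))
      rw [norm_neg, norm_exp_ofReal_mul, norm_real, Real.norm_of_nonneg hx.le, sub_neg_eq_add,
        add_comm (x : ℂ)] at this
      linarith
    gcongr
  · have ht : Tendsto (fun u : ℝ => Real.exp (α * u)) atBot (𝓝 0) :=
      Real.tendsto_exp_atBot.comp (tendsto_id.const_mul_atBot hα)
    have h' := (Real.continuous_exp.tendsto 0).comp Real.tendsto_exp_atBot
    simpa using h'.mul (ht.div_const (x / 2))

end MittagLeffler

/-! ### Asymptotics, decay constants and eventual monotonicity of E_{α,1}(-x). -/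

section MittagLefflerAsymptotics
open Set Complex

/-- The integrand of the remainder `1 / (Γ(1-α) x) - E_{α,1}(-x)`. -/
noncomputable def mlRemainder (α x : ℝ) (w : ℂ) : ℂ :=
  cexp (cexp w) * cexp ((2 * α : ℝ) * w) * (x * (cexp (α * w) + x))⁻¹

/-- With A = e^{αw}, this is 1/(A+x) = 1/x - A/(x(A+x)). The first piece integrates to the leading
term 1/(Γ(1-α)x). -/
lemma mlIntegrand_eq_sub {α x : ℝ} {w : ℂ} (hx : x ≠ 0) (hne : cexp (α * w) + x ≠ 0) :
    mlIntegrand α x w = (x : ℂ)⁻¹ * (cexp (cexp w) * cexp (α * w)) - mlRemainder α x w := by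
  unfold mlIntegrand mlRemainder
  have h2 : cexp ((2 * α : ℝ) * w) = cexp (α * w) * cexp (α * w) := by
    rw [← Complex.exp_add]
    push_cast
    ring_nf
  have hx' : (x : ℂ) ≠ 0 := ofReal_ne_zero.2 hx
  rw [h2]
  field_simp
  ring

lemma norm_mlRemainder_le {α θ x : ℝ} (hs : 0 < Real.sin (α * θ)) (hx : 0 < x) (u : ℝ) :
    ‖mlRemainder α x (u + θ * I)‖ ≤
      ‖cexp (cexp (u + θ * I)) * cexp ((2 * α : ℝ) * (u + θ * I))‖ *
        (x ^ 2 * Real.sin (α * θ))⁻¹ := by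
  unfold mlRemainder
  rw [norm_mul _ (_⁻¹), norm_inv, norm_mul (x : ℂ), norm_real, Real.norm_of_nonneg hx.le,
    pow_two, mul_assoc x x]
  gcongr
  exact mul_sin_le_norm_exp_add_ofReal α θ u x

/-- Extracts from an increment of the remainder the factor 1/x₁ - 1/x₂ that the increment of the
leading term also carries, so that the two can be compared. -/
lemma inv_mul_add_sub_inv_mul_add {A p q : ℂ} (hp : p ≠ 0) (hq : q ≠ 0) (hA : A + p ≠ 0)
    (hB : A + q ≠ 0) :
    (p * (A + p))⁻¹ - (q * (A + q))⁻¹ =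
      (p⁻¹ - q⁻¹) * ((A + p)⁻¹ + p * ((A + p)⁻¹ * (A + q)⁻¹)) := by
  field_simp
  ring

lemma norm_mlRemainder_sub_le {α θ x₁ x₂ : ℝ} (hs : 0 < Real.sin (α * θ)) (h0 : 0 < x₁)
    (h12 : x₁ ≤ x₂) (u : ℝ) :
    ‖mlRemainder α x₁ (u + θ * I) - mlRemainder α x₂ (u + θ * I)‖ ≤
      ‖cexp (cexp (u + θ * I)) * cexp ((2 * α : ℝ) * (u + θ * I))‖ *
        ((x₁⁻¹ - x₂⁻¹) * (((Real.sin (α * θ))⁻¹ + (Real.sin (α * θ))⁻¹ ^ 2) * x₁⁻¹)) := by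
  have h0' : 0 < x₂ := h0.trans_le h12
  set s := Real.sin (α * θ) with hsdef
  have hn1 : x₁ * s ≤ ‖cexp (α * (u + θ * I)) + x₁‖ := mul_sin_le_norm_exp_add_ofReal α θ u x₁
  have hn2 : x₁ * s ≤ ‖cexp (α * (u + θ * I)) + x₂‖ :=
    le_trans (by gcongr) (mul_sin_le_norm_exp_add_ofReal α θ u x₂)
  have hpos : 0 < x₁ * s := by positivity
  have hA := norm_pos_iff.1 (hpos.trans_le hn1)
  have hB := norm_pos_iff.1 (hpos.trans_le hn2)
  unfold mlRemainder
  rw [← mul_sub, norm_mul, inv_mul_add_sub_inv_mul_add (ofReal_ne_zero.2 h0.ne')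
    (ofReal_ne_zero.2 h0'.ne') hA hB, norm_mul (_ - _)]
  have hinv : 0 ≤ x₁⁻¹ - x₂⁻¹ := sub_nonneg.2 (inv_anti₀ h0 h12)
  have e1 : ‖(x₁ : ℂ)⁻¹ - (x₂ : ℂ)⁻¹‖ = x₁⁻¹ - x₂⁻¹ := by
    rw [← ofReal_inv, ← ofReal_inv, ← ofReal_sub, norm_real, Real.norm_of_nonneg hinv]
  have e2 : ‖(cexp (α * (u + θ * I)) + x₁)⁻¹‖ ≤ (x₁ * s)⁻¹ := by
    rw [norm_inv]
    exact inv_anti₀ hpos hn1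
  have e3 : ‖(cexp (α * (u + θ * I)) + x₂)⁻¹‖ ≤ (x₁ * s)⁻¹ := by
    rw [norm_inv]
    exact inv_anti₀ hpos hn2
  rw [e1]
  gcongr
  refine (norm_add_le _ _).trans ?_
  rw [norm_mul, norm_mul, norm_real, Real.norm_of_nonneg h0.le]
  calc _ ≤ (x₁ * s)⁻¹ + x₁ * ((x₁ * s)⁻¹ * (x₁ * s)⁻¹) := by gcongr
    _ = _ := by field_simp

lemma Gamma_one_sub_neg {α : ℝ} (h1 : 1 < α) (h2 : α < 2) : Real.Gamma (1 - α) < 0 := by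
  have h := Real.Gamma_add_one (s := 1 - α) (by linarith)
  have hp := Real.Gamma_pos_of_pos (s := 1 - α + 1) (by linarith)
  nlinarith

/-- First-order asymptotics of `E_{α,1}(-x)` as `x → ∞`, together with a first-order estimate for
the increments of the remainder. -/
theorem mittagLeffler_one_neg_asymptotics {α : ℝ} (hα₁ : 1 < α) (hα₂ : α < 2) :
    ∃ K : ℝ, 0 < K ∧
      (∀ x : ℝ, 0 < x →
        |mittagLeffler α 1 (-x) - (Real.Gamma (1 - α) * x)⁻¹| ≤ K / x ^ 2) ∧
      ∀ x₁ x₂ : ℝ, 0 < x₁ → x₁ ≤ x₂ →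
        |(mittagLeffler α 1 (-x₂) - (Real.Gamma (1 - α) * x₂)⁻¹) -
          (mittagLeffler α 1 (-x₁) - (Real.Gamma (1 - α) * x₁)⁻¹)| ≤
            (x₁⁻¹ - x₂⁻¹) * (K / x₁) := by
  have hπ := Real.pi_pos
  have hα : 0 < α := by linarith
  have hπα : Real.pi / 2 < Real.pi / α := div_lt_div_of_pos_left hπ hα hα₂
  -- θ > π/2 makes e^{e^w} decay along the ray, and θ < π/α avoids the zeros of e^{αw} + x; α < 2
  -- leaves room between.
  obtain ⟨θ, h1, hθα⟩ := exists_between hπα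
  have hθ : 0 < θ := lt_trans (by positivity) h1
  have hαθ : α * θ < Real.pi := by rwa [lt_div_iff₀' hα] at hθα
  have h2 : θ < Real.pi := by nlinarith
  have hc : Real.cos θ < 0 := Real.cos_neg_of_pi_div_two_lt_of_lt h1 (by linarith)
  have hs : 0 < Real.sin (α * θ) := Real.sin_pos_of_pos_of_lt_pi (by positivity) hαθ
  set s := Real.sin (α * θ) with hsdef
  set N : ℝ → ℝ := fun u => ‖cexp (cexp (u + θ * I)) * cexp ((2 * α : ℝ) * (u + θ * I))‖
  have hN : Integrable N := (integrable_exp_exp_mul_exp_ray (b := 2 * α) (by positivity) hc).norm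
  have hNnn : 0 ≤ ∫ u, N u := integral_nonneg fun u => norm_nonneg _
  have hrc : ∀ x : ℝ, 0 < x → Continuous fun u : ℝ => mlRemainder α x (u + θ * I) := by
    intro x hx
    unfold mlRemainder
    refine Continuous.mul (by fun_prop) (Continuous.inv₀ (by fun_prop) fun u => ?_)
    exact mul_ne_zero (ofReal_ne_zero.2 hx.ne') (exp_add_ofReal_ne_zero hα hαθ hx ⟨hθ.le, le_rfl⟩ u)
  have hri : ∀ x : ℝ, 0 < x → Integrable fun u : ℝ => mlRemainder α x (u + θ * I) := fun x hx =>
    (hN.mul_const _).mono' (hrc x hx).aestronglyMeasurable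
      (Eventually.of_forall fun u => norm_mlRemainder_le hs hx u)
  have hrep : ∀ x : ℝ, 0 < x → mittagLeffler α 1 (-x) - (Real.Gamma (1 - α) * x)⁻¹ =
      -((∫ u : ℝ, mlRemainder α x (u + θ * I)).im / Real.pi) := by
    intro x hx
    rw [mittagLeffler_one_neg_eq_integral hα h1 h2 hαθ hx]
    have : ∫ u : ℝ, mlIntegrand α x (u + θ * I) =
        (x : ℂ)⁻¹ * (Real.Gamma α * cexp (α * Real.pi * I)) -
          ∫ u : ℝ, mlRemainder α x (u + θ * I) := by
      rw [← integral_exp_exp_mul_exp_ray hα h1 h2, ← integral_const_mul, ← integral_sub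
        ((integrable_exp_exp_mul_exp_ray hα hc).const_mul _) (hri x hx)]
      refine integral_congr_ae (Eventually.of_forall fun u => ?_)
      exact mlIntegrand_eq_sub hx.ne' (exp_add_ofReal_ne_zero hα hαθ hx ⟨hθ.le, le_rfl⟩ u)
    have him : (cexp (α * Real.pi * I)).im = Real.sin (Real.pi * α) := by
      rw [exp_im]
      simp [mul_comm]
    rw [this, sub_im, ← ofReal_inv, im_ofReal_mul, im_ofReal_mul, him]
    have hG := Real.Gamma_mul_Gamma_one_sub α
    have hsin : Real.sin (Real.pi * α) ≠ 0 := by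
      have h : Real.sin (Real.pi * α - Real.pi) ≠ 0 :=
        (Real.sin_pos_of_pos_of_lt_pi (by nlinarith) (by nlinarith)).ne'
      rw [Real.sin_sub_pi] at h
      exact neg_ne_zero.1 h
    have hΓ := (Gamma_one_sub_neg hα₁ hα₂).ne
    rw [eq_div_iff hsin] at hG
    have : Real.Gamma α * Real.sin (Real.pi * α) / Real.pi = (Real.Gamma (1 - α))⁻¹ := by
      rw [div_eq_iff hπ.ne', eq_inv_mul_iff_mul_eq₀ hΓ]
      linarith
    rw [sub_div, mul_inv, ← this]
    ring
  -- The increment bound needs s⁻¹ + s⁻²; the size bound needs only s⁻¹. The added 1 makes K visibly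
  -- positive.
  refine ⟨(∫ u, N u) / Real.pi * (s⁻¹ + s⁻¹ ^ 2) + 1, by positivity, fun x hx => ?_,
    fun x₁ x₂ h0 h12 => ?_⟩
  · rw [hrep x hx, abs_neg, abs_div, abs_of_pos hπ]
    have hb : |(∫ u : ℝ, mlRemainder α x (u + θ * I)).im| ≤ (∫ u, N u) * (x ^ 2 * s)⁻¹ := by
      refine (abs_im_le_norm _).trans ?_
      rw [← integral_mul_const]
      exact norm_integral_le_of_norm_le (hN.mul_const _)
        (Eventually.of_forall fun u => norm_mlRemainder_le hs hx u)
    calc _ ≤ (∫ u, N u) * (x ^ 2 * s)⁻¹ / Real.pi := by gcongr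
      _ = (∫ u, N u) / Real.pi * s⁻¹ / x ^ 2 := by rw [mul_inv]; ring
      _ ≤ _ := by
        gcongr
        have : 0 ≤ (∫ u, N u) / Real.pi * s⁻¹ ^ 2 := by positivity
        linarith
  · have h0' := h0.trans_le h12
    rw [hrep x₁ h0, hrep x₂ h0', neg_sub_neg, ← sub_div, ← sub_im,
      ← integral_sub (hri x₁ h0) (hri x₂ h0'), abs_div, abs_of_pos hπ]
    have hinv : 0 ≤ x₁⁻¹ - x₂⁻¹ := sub_nonneg.2 (inv_anti₀ h0 h12)
    have hb : |(∫ u : ℝ, mlRemainder α x₁ (u + θ * I) - mlRemainder α x₂ (u + θ * I)).im| ≤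
        (∫ u, N u) * ((x₁⁻¹ - x₂⁻¹) * ((s⁻¹ + s⁻¹ ^ 2) * x₁⁻¹)) := by
      refine (abs_im_le_norm _).trans ?_
      rw [← integral_mul_const]
      exact norm_integral_le_of_norm_le (hN.mul_const _)
        (Eventually.of_forall fun u => norm_mlRemainder_sub_le hs h0 h12 u)
    calc _ ≤ (∫ u, N u) * ((x₁⁻¹ - x₂⁻¹) * ((s⁻¹ + s⁻¹ ^ 2) * x₁⁻¹)) / Real.pi := by gcongr
      _ = (x₁⁻¹ - x₂⁻¹) * ((∫ u, N u) / Real.pi * (s⁻¹ + s⁻¹ ^ 2) / x₁) := by ring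
      _ ≤ _ := by
        gcongr
        linarith

/-- Convergence is read off from the contour representation, with 3π/4 an arbitrary angle in (π/2,
π), instead of from the growth of Γ. -/
lemma summable_pow_div_Gamma {α : ℝ} (hα : 0 < α) {x : ℝ} (hx : 0 < x) :
    Summable fun k : ℕ => x ^ k / Real.Gamma (α * k + 1) := by
  have hπ := Real.pi_pos
  have hL : x * Real.exp (-(α * (Real.log (2 * x) / α))) < 1 := by
    rw [mul_div_cancel₀ _ hα.ne', Real.exp_neg, Real.exp_log (by positivity), mul_inv,
      mul_left_comm, mul_inv_cancel₀ hx.ne']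
    norm_num
  refine ((hasSum_mittagLeffler_hankelIntegral (θ := 3 * Real.pi / 4) hα (by linarith)
    (by linarith) hx.le hL).summable.abs).congr fun k => ?_
  have := Real.Gamma_pos_of_pos (s := α * k + 1) (by positivity)
  rw [abs_div, abs_pow, abs_neg, abs_of_pos hx, abs_of_pos this]

lemma summable_neg_pow_div_Gamma {α : ℝ} (hα : 0 < α) {x : ℝ} (hx : 0 < x) :
    Summable fun k : ℕ => (-x) ^ k / Real.Gamma (α * k + 1) := by
  refine Summable.of_norm_bounded (summable_pow_div_Gamma hα hx) fun k => ?_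
  have := Real.Gamma_pos_of_pos (s := α * k + 1) (by positivity)
  rw [norm_div, norm_pow, norm_neg, Real.norm_of_nonneg hx.le, Real.norm_of_nonneg this.le]

/-- `x E_{α,α+1}(-x) = 1 - E_{α,1}(-x)`. -/
lemma mul_mittagLeffler_add_one_neg {α : ℝ} (hα : 0 < α) {x : ℝ} (hx : 0 < x) :
    x * mittagLeffler α (α + 1) (-x) = 1 - mittagLeffler α 1 (-x) := by
  have h := (summable_neg_pow_div_Gamma hα hx).tsum_eq_zero_add
  unfold mittagLeffler
  rw [h, ← tsum_mul_left]
  simp only [Nat.cast_zero, mul_zero, zero_add, pow_zero, Real.Gamma_one, div_one]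
  rw [← sub_sub, sub_self, zero_sub, ← tsum_neg]
  refine tsum_congr fun k => ?_
  rw [pow_succ]
  push_cast
  rw [show α * (k + 1 : ℝ) + 1 = α * k + (α + 1) by ring]
  ring

lemma abs_mittagLeffler_neg_le {α β x : ℝ} (hβ : 0 ≤ β) (hα : 0 < α)
    (hsum : Summable fun k : ℕ => (Real.Gamma (α * k + (β + 1)))⁻¹) (hx0 : 0 ≤ x) (hx1 : x ≤ 1) :
    |mittagLeffler α (β + 1) (-x)| ≤ ∑' k : ℕ, (Real.Gamma (α * k + (β + 1)))⁻¹ := by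
  refine tsum_of_norm_bounded (f := fun k : ℕ => (-x) ^ k / Real.Gamma (α * k + (β + 1)))
    hsum.hasSum fun k => ?_
  have := Real.Gamma_pos_of_pos (s := α * k + (β + 1)) (by positivity)
  rw [norm_div, norm_pow, norm_neg, Real.norm_of_nonneg hx0, Real.norm_of_nonneg this.le,
    div_eq_mul_inv]
  exact mul_le_of_le_one_left (by positivity) (pow_le_one₀ hx0 hx1)

lemma summable_inv_Gamma {α : ℝ} (hα : 0 < α) :
    Summable fun k : ℕ => (Real.Gamma (α * k + 1))⁻¹ :=
  (summable_pow_div_Gamma hα one_pos).congr fun k => by rw [one_pow, one_div]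

lemma isDecayConst_of_bounds {α β A B : ℝ} (hA : 0 ≤ A) (hB : 0 ≤ B)
    (h1 : ∀ x : ℝ, 0 ≤ x → x ≤ 1 → |mittagLeffler α β (-x)| ≤ A)
    (h2 : ∀ x : ℝ, 1 ≤ x → |mittagLeffler α β (-x)| ≤ B / x) :
    IsDecayConst α β (2 * (A + B) + 1) := by
  -- The factor 2 covers 1 + x ≤ 2 on [0, 1] and 1 + x ≤ 2x beyond; the added 1 gives strict
  -- positivity.
  refine ⟨by positivity, fun x hx => ?_⟩
  rw [le_div_iff₀ (by positivity)]
  rcases le_total x 1 with hx1 | hx1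
  · nlinarith [h1 x hx hx1, abs_nonneg (mittagLeffler α β (-x))]
  · have h := h2 x hx1
    rw [le_div_iff₀ (by positivity)] at h
    nlinarith [abs_nonneg (mittagLeffler α β (-x))]

theorem exists_isDecayConst_one {α : ℝ} (hα₁ : 1 < α) (hα₂ : α < 2) :
    ∃ C, IsDecayConst α 1 C := by
  obtain ⟨K, hK, h, -⟩ := mittagLeffler_one_neg_asymptotics hα₁ hα₂
  have hα : 0 < α := by linarith
  have hs := summable_inv_Gamma hα
  refine ⟨_, isDecayConst_of_bounds (A := ∑' k : ℕ, (Real.Gamma (α * k + 1))⁻¹)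
    (B := |(Real.Gamma (1 - α))⁻¹| + K)
    (tsum_nonneg fun k => (inv_pos.2 (Real.Gamma_pos_of_pos (by positivity))).le)
    (by positivity) (fun x h0 h1 => ?_) fun x hx => ?_⟩
  · have := abs_mittagLeffler_neg_le (α := α) (β := 0) le_rfl hα (by simpa using hs) h0 h1
    simpa using this
  · have hx0 : 0 < x := by linarith
    have h' := h x hx0
    have e : |(Real.Gamma (1 - α) * x)⁻¹| = |(Real.Gamma (1 - α))⁻¹| / x := by
      rw [mul_inv, abs_mul, abs_of_pos (inv_pos.2 hx0), div_eq_mul_inv]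
    have hK2 : K / x ^ 2 ≤ K / x := by
      gcongr
      nlinarith
    have := abs_sub_abs_le_abs_sub (mittagLeffler α 1 (-x)) (Real.Gamma (1 - α) * x)⁻¹
    rw [add_div]
    linarith

/-- For x ≥ 1 the decay is inherited from boundedness of E_{α,1} through x E_{α,α+1}(-x) = 1 -
E_{α,1}(-x). -/
theorem exists_isDecayConst_add_one {α : ℝ} (hα₁ : 1 < α) (hα₂ : α < 2) :
    ∃ C, IsDecayConst α (α + 1) C := by
  obtain ⟨C, hC0, hC⟩ := exists_isDecayConst_one hα₁ hα₂
  have hα : 0 < α := by linarith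
  have hs : Summable fun k : ℕ => (Real.Gamma (α * k + (α + 1)))⁻¹ := by
    refine ((summable_nat_add_iff 1).2 (summable_inv_Gamma hα)).congr fun k => ?_
    push_cast
    ring_nf
  refine ⟨_, isDecayConst_of_bounds (A := ∑' k : ℕ, (Real.Gamma (α * k + (α + 1)))⁻¹)
    (B := 1 + C) (tsum_nonneg fun k => (inv_pos.2 (Real.Gamma_pos_of_pos (by positivity))).le)
    (by positivity) (fun x h0 h1 => abs_mittagLeffler_neg_le hα.le hα hs h0 h1) fun x hx => ?_⟩
  have hx0 : 0 < x := by linarith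
  rw [le_div_iff₀ hx0, mul_comm, ← abs_of_pos hx0, ← abs_mul, abs_of_pos hx0,
    mul_mittagLeffler_add_one_neg hα hx0]
  have h1 : C / (1 + x) ≤ C := div_le_self hC0.le (by linarith)
  have h2 := hC x hx0.le
  have h3 := abs_sub (1 : ℝ) (mittagLeffler α 1 (-x))
  rw [abs_one] at h3
  linarith

/-- For large `x`, `E_{α,1}(-x)` is negative and increasing at least half as fast as its leading
term `1 / (Γ(1-α) x)`. -/
theorem exists_mittagLeffler_one_neg_lower {α : ℝ} (hα₁ : 1 < α) (hα₂ : α < 2) :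
    ∃ X : ℝ, 0 < X ∧
      (∀ x, X ≤ x → mittagLeffler α 1 (-x) ≤ -(1 / (2 * |Real.Gamma (1 - α)|) * x⁻¹)) ∧
      ∀ x₁ x₂, X ≤ x₁ → x₁ ≤ x₂ →
        1 / (2 * |Real.Gamma (1 - α)|) * (x₁⁻¹ - x₂⁻¹) ≤
          mittagLeffler α 1 (-x₂) - mittagLeffler α 1 (-x₁) := by
  obtain ⟨K, hK, h, h'⟩ := mittagLeffler_one_neg_asymptotics hα₁ hα₂
  have hΓ := Gamma_one_sub_neg hα₁ hα₂
  set γ := |Real.Gamma (1 - α)| with hγ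
  have hγ0 : 0 < γ := abs_pos.2 hΓ.ne
  have hΓ' : Real.Gamma (1 - α) = -γ := by rw [hγ, abs_of_neg hΓ, neg_neg]
  have hKx : ∀ x, 2 * γ * K ≤ x → K / x ≤ 1 / (2 * γ) := by
    intro x hx
    have : 0 < x := lt_of_lt_of_le (by positivity) hx
    rw [div_le_div_iff₀ this (by positivity)]
    linarith
  -- Beyond x = 2γK the error terms are at most half of the leading terms, whose coefficient is 1/γ
  -- in absolute value.
  refine ⟨2 * γ * K, by positivity, fun x hx => ?_, fun x₁ x₂ hx h12 => ?_⟩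
  · have hx0 : 0 < x := lt_of_lt_of_le (by positivity) hx
    have h1 := (abs_le.1 (h x hx0)).2
    have h2 : K / x ^ 2 ≤ 1 / (2 * γ) * x⁻¹ := by
      rw [pow_two, ← div_div, div_eq_mul_inv _ x]
      exact mul_le_mul_of_nonneg_right (hKx x hx) (by positivity)
    have e : (Real.Gamma (1 - α) * x)⁻¹ = -(2 * (1 / (2 * γ) * x⁻¹)) := by
      rw [hΓ']
      field_simp
    linarith
  · have hx0 : 0 < x₁ := lt_of_lt_of_le (by positivity) hx
    have hinv : 0 ≤ x₁⁻¹ - x₂⁻¹ := sub_nonneg.2 (inv_anti₀ hx0 h12)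
    have h1 := (abs_le.1 (h' x₁ x₂ hx0 h12)).1
    have h2 := mul_le_mul_of_nonneg_left (hKx x₁ hx) hinv
    have hx2 : 0 < x₂ := hx0.trans_le h12
    have e : (Real.Gamma (1 - α) * x₂)⁻¹ - (Real.Gamma (1 - α) * x₁)⁻¹ =
        2 * (1 / (2 * γ) * (x₁⁻¹ - x₂⁻¹)) := by
      rw [hΓ']
      field_simp
      ring
    linarith

end MittagLefflerAsymptotics

/-! ### Poincaré's inequality and a positive lower bound for the Dirichlet eigenvalues. -/

section Poincare

variable {N : ℕ}

lemma continuous_gradient_of_contDiff {η : EuclideanSpace ℝ (Fin N) → ℝ} (h : ContDiff ℝ ∞ η) :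
    Continuous (gradient η) := by
  unfold gradient
  exact (LinearIsometryEquiv.continuous _).comp (h.continuous_fderiv (by simp))

lemma hasCompactSupport_gradient {η : EuclideanSpace ℝ (Fin N) → ℝ} (h : HasCompactSupport η) :
    HasCompactSupport (gradient η) := by
  refine (h.fderiv ℝ).comp_left (g := (InnerProductSpace.toDual ℝ _).symm) (map_zero _)

lemma gradient_eq_zero_of_notMem_tsupport {η : EuclideanSpace ℝ (Fin N) → ℝ}
    {x : EuclideanSpace ℝ (Fin N)} (h : x ∉ tsupport η) : gradient η x = 0 := by
  unfold gradient
  rw [fderiv_of_notMem_tsupport ℝ h, map_zero]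

lemma IsTestFunction.memLp {Ω : Set (EuclideanSpace ℝ (Fin N))}
    {η : EuclideanSpace ℝ (Fin N) → ℝ} (h : IsTestFunction Ω η) :
    MemLp η 2 (volume.restrict Ω) :=
  (h.smooth.continuous.memLp_of_hasCompactSupport h.compact).restrict Ω

lemma IsTestFunction.memLp_gradient {Ω : Set (EuclideanSpace ℝ (Fin N))}
    {η : EuclideanSpace ℝ (Fin N) → ℝ} (h : IsTestFunction Ω η) :
    MemLp (gradient η) 2 (volume.restrict Ω) :=
  ((continuous_gradient_of_contDiff h.smooth).memLp_of_hasCompactSupport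
    (hasCompactSupport_gradient h.compact)).restrict Ω

/-- Poincaré's inequality for test functions on a bounded set. -/
theorem IsTestFunction.poincare {Ω : Set (EuclideanSpace ℝ (Fin N))} (i : Fin N) {M : ℝ}
    (hM : ∀ x ∈ Ω, ‖x‖ ≤ M) {η : EuclideanSpace ℝ (Fin N) → ℝ} (h : IsTestFunction Ω η) :
    ∫ x in Ω, η x ^ 2 ≤ 4 * M ^ 2 * ∫ x in Ω, ‖gradient η x‖ ^ 2 := by
  have hηc := h.smooth.continuous
  have hgc := continuous_gradient_of_contDiff h.smooth
  have hd : Differentiable ℝ η := h.smooth.differentiable (by simp)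
  have hfc : Continuous (fderiv ℝ η) := h.smooth.continuous_fderiv (by simp)
  rw [setIntegral_eq_integral_of_forall_compl_eq_zero fun x hx => by
      rw [image_eq_zero_of_notMem_tsupport fun hx' => hx (h.support_subset hx'),
        zero_pow two_ne_zero],
    setIntegral_eq_integral_of_forall_compl_eq_zero fun x hx => by
      rw [gradient_eq_zero_of_notMem_tsupport fun hx' => hx (h.support_subset hx'), norm_zero,
        zero_pow two_ne_zero]]
  set v : EuclideanSpace ℝ (Fin N) := EuclideanSpace.single i 1 with hv
  have hvn : ‖v‖ = 1 := by simp [hv]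
  have hcs : ∀ {f : EuclideanSpace ℝ (Fin N) → ℝ}, Continuous f →
      (∀ x, η x = 0 → f x = 0) → Integrable f := fun hf h0 =>
    hf.integrable_of_hasCompactSupport (h.compact.mono fun x hx hx0 => hx (h0 x hx0))
  set p : EuclideanSpace ℝ (Fin N) →L[ℝ] ℝ := EuclideanSpace.proj i with hp
  have hfd : ∀ x, fderiv ℝ (fun x => η x ^ 2) x v = 2 * η x * fderiv ℝ η x v := fun x => by
    rw [((hd x).hasFDerivAt.pow 2).fderiv]
    simp
  have hpd : ∀ x, fderiv ℝ (fun x => p x) x v = 1 := fun x => by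
    rw [p.fderiv]
    simp [hp, hv]
  -- Since ∂ᵢxᵢ = 1, integrating η² ∂ᵢxᵢ by parts gives ∫ η² = -∫ 2η ∂ᵢη xᵢ, and |xᵢ| ≤ M on Ω.
  have hibp := integral_mul_fderiv_eq_neg_fderiv_mul_of_integrable (μ := volume)
    (f := fun x => η x ^ 2) (g := fun x => p x) (v := v)
    (by
      simp only [hfd]
      exact hcs (by fun_prop) fun x hx => by simp [hx])
    (by
      simp only [hpd]
      exact hcs (by fun_prop) fun x hx => by simp [hx])
    (hcs (by fun_prop) fun x hx => by simp [hx])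
    (fun x _ => (hd x).pow 2) (fun x _ => p.differentiableAt)
  simp only [hpd, hfd, mul_one] at hibp
  have hi1 : Integrable fun x => η x ^ 2 := hcs (by fun_prop) fun x hx => by simp [hx]
  have hi2 : Integrable fun x => ‖gradient η x‖ ^ 2 := by
    have hcg : HasCompactSupport fun x => ‖gradient η x‖ ^ 2 :=
      (hasCompactSupport_gradient h.compact).mono fun x hx hx0 => hx (by simp [hx0])
    exact Continuous.integrable_of_hasCompactSupport (by fun_prop) hcg
  have hi3 : Integrable fun x => 2 * η x * fderiv ℝ η x v * p x :=
    hcs (by fun_prop) fun x hx => by simp [hx]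
  have hle : ∀ x, -(2 * η x * fderiv ℝ η x v * p x) ≤
      1 / 2 * η x ^ 2 + 2 * M ^ 2 * ‖gradient η x‖ ^ 2 := by
    intro x
    by_cases hx : η x = 0
    · simp only [hx]
      norm_num
      positivity
    have hxM : |p x| ≤ M := by
      have : ‖x i‖ ≤ ‖x‖ := PiLp.norm_apply_le x i
      exact this.trans (hM x (h.support_subset (subset_tsupport _ hx)))
    have hg : |fderiv ℝ η x v| ≤ ‖gradient η x‖ := by
      have h1 := (fderiv ℝ η x).le_opNorm v
      rw [hvn, mul_one] at h1
      unfold gradient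
      rwa [LinearIsometryEquiv.norm_map]
    have hprod : |fderiv ℝ η x v * p x| ≤ ‖gradient η x‖ * M := by
      rw [abs_mul]
      gcongr
    have hsq : (fderiv ℝ η x v * p x) ^ 2 ≤ (‖gradient η x‖ * M) ^ 2 := sq_le_sq' (by
      linarith [(abs_le.1 hprod).1]) (abs_le.1 hprod).2
    -- Young's inequality, weighted so that half of ∫ η² can be absorbed on the left; this produces
    -- the constant 4M².
    nlinarith [sq_nonneg (η x + 2 * (fderiv ℝ η x v * p x))]
  have hmono := integral_mono hi3.neg ((hi1.const_mul (1 / 2)).add (hi2.const_mul (2 * M ^ 2))) hle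
  simp only [Pi.neg_apply, Pi.add_apply] at hmono
  rw [integral_neg, integral_add (hi1.const_mul _) (hi2.const_mul _), integral_const_mul,
    integral_const_mul, ← hibp] at hmono
  linarith

lemma norm_toLp_sq {E : Type*} [NormedAddCommGroup E] [InnerProductSpace ℝ E]
    {Ω : Set (EuclideanSpace ℝ (Fin N))} {f : EuclideanSpace ℝ (Fin N) → E}
    (hf : MemLp f 2 (volume.restrict Ω)) :
    ‖hf.toLp f‖ ^ 2 = ∫ x in Ω, ‖f x‖ ^ 2 := by
  rw [← real_inner_self_eq_norm_sq, L2.inner_def]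
  refine integral_congr_ae ?_
  filter_upwards [hf.coeFn_toLp] with x hx
  rw [hx, real_inner_self_eq_norm_sq]

lemma inner_toLp_toLp {E : Type*} [NormedAddCommGroup E] [InnerProductSpace ℝ E]
    {Ω : Set (EuclideanSpace ℝ (Fin N))} {f g : EuclideanSpace ℝ (Fin N) → E}
    (hf : MemLp f 2 (volume.restrict Ω)) (hg : MemLp g 2 (volume.restrict Ω)) :
    inner ℝ (hf.toLp f) (hg.toLp g) = ∫ x in Ω, inner ℝ (f x) (g x) := by
  rw [L2.inner_def]
  refine integral_congr_ae ?_
  filter_upwards [hf.coeFn_toLp, hg.coeFn_toLp] with x hx hx'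
  rw [hx, hx']

/-- Dirichlet eigenvalues of a bounded set are bounded below by a positive constant. -/
theorem IsDirichletEigenfunction.one_le_mul {Ω : Set (EuclideanSpace ℝ (Fin N))} (i : Fin N)
    {M l : ℝ} (hM : ∀ x ∈ Ω, ‖x‖ ≤ M) {u : L2 Ω} (hu : ‖u‖ = 1)
    (h : IsDirichletEigenfunction Ω l u) : 1 ≤ 4 * M ^ 2 * l := by
  obtain ⟨G, ⟨hum, hGm, η, hη, hηu, hηG⟩, hweak⟩ := h
  have hU : hum.toLp u = u := Lp.toLp_coeFn u hum
  set A : ℕ → L2 Ω := fun j => (hη j).memLp.toLp (η j)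
  set D : ℕ → Lp (EuclideanSpace ℝ (Fin N)) 2 (volume.restrict Ω) :=
    fun j => (hη j).memLp_gradient.toLp (gradient (η j))
  have hA : Tendsto A atTop (𝓝 u) := by
    rw [← hU]
    exact (Lp.tendsto_Lp_iff_tendsto_eLpNorm'' _ _ _ _).2 hηu
  have hD : Tendsto D atTop (𝓝 (hGm.toLp G)) :=
    (Lp.tendsto_Lp_iff_tendsto_eLpNorm'' _ _ _ _).2 hηG
  have hP : ‖u‖ ^ 2 ≤ 4 * M ^ 2 * ‖hGm.toLp G‖ ^ 2 := by
    refine le_of_tendsto_of_tendsto' (hA.norm.pow 2) ((hD.norm.pow 2).const_mul _) fun j => ?_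
    rw [norm_toLp_sq, norm_toLp_sq]
    simpa using (hη j).poincare i hM
  have hE : inner ℝ (hGm.toLp G) (hGm.toLp G) = l * inner ℝ u u := by
    -- The weak equation is tested with the approximants η_j and passed to the limit, which amounts
    -- to testing with u itself.
    refine tendsto_nhds_unique (tendsto_const_nhds.inner hD)
      (((tendsto_const_nhds (x := u)).inner hA |>.const_mul l).congr fun j => ?_)
    rw [inner_toLp_toLp, hweak _ (hη j)]
    conv_lhs => rw [← hU, inner_toLp_toLp]
    congr 1
    refine integral_congr_ae (Eventually.of_forall fun x => ?_)
    simp [mul_comm]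
  rw [real_inner_self_eq_norm_sq, real_inner_self_eq_norm_sq, hu] at hE
  rw [hE, hu] at hP
  linarith

end Poincare

/-! ### Uniform bounds for S, Q and the contraction ratio on one eigenspace. -/

section Coefficients

variable {α l T T₁ T₂ C₁ C₂ : ℝ}

lemma mul_Qcoef (hα : 0 < α) (hl : 0 < l) (hT : 0 < T) :
    l * Qcoef α l T = 1 - Scoef α l T := by
  unfold Qcoef Scoef
  rw [← mul_assoc]
  exact mul_mittagLeffler_add_one_neg hα (by positivity)

lemma abs_Scoef_le (hl : 0 < l) (hT : 0 < T) (hC : IsDecayConst α 1 C₁) :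
    |Scoef α l T| ≤ C₁ / (1 + l * T ^ α) :=
  hC.2 _ (by positivity)

lemma abs_Scoef_le_const (hl : 0 < l) (hT : 0 < T) (hC : IsDecayConst α 1 C₁) :
    |Scoef α l T| ≤ C₁ :=
  (abs_Scoef_le hl hT hC).trans (div_le_self hC.1.le (by
    have : 0 < l * T ^ α := by positivity
    linarith))

lemma abs_Qcoef_le (hl : 0 < l) (hT : 0 < T) (hC : IsDecayConst α (α + 1) C₂) :
    |Qcoef α l T| ≤ T ^ α * (C₂ / (1 + l * T ^ α)) := by
  unfold Qcoef
  rw [abs_mul, abs_of_pos (Real.rpow_pos_of_pos hT α)]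
  gcongr
  exact hC.2 _ (by positivity)

lemma abs_Qcoef_le_const (hl : 0 < l) (hT : 0 < T) (hC : IsDecayConst α (α + 1) C₂) :
    |Qcoef α l T| ≤ T ^ α * C₂ := by
  refine (abs_Qcoef_le hl hT hC).trans ?_
  gcongr
  refine div_le_self hC.1.le ?_
  have : 0 < l * T ^ α := by positivity
  linarith

lemma dConst_pos (hT₁ : 0 < T₁) (hT₂ : 0 < T₂) : 0 < dConst α T₁ T₂ C₁ C₂ :=
  lt_max_of_lt_left (by positivity)

lemma dConst_lt_one (hα : 0 < α) (hΓ : Real.Gamma (1 - α) ≠ 0) (hT₁ : 0 < T₁) (hT : T₁ < T₂)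
    (hC₁ : 0 < C₁) (hC₂ : 0 < C₂) : dConst α T₁ T₂ C₁ C₂ < 1 := by
  have hr : T₁ ^ α / T₂ ^ α < 1 :=
    (div_lt_one (Real.rpow_pos_of_pos (hT₁.trans hT) α)).2 (Real.rpow_lt_rpow hT₁.le hT hα)
  refine max_lt hr ?_
  have : 0 < 1 / (2 * C₁ * C₂ * |Real.Gamma (1 - α)|) := by positivity
  have := mul_pos this (sub_pos.2 hr)
  linarith

/-- Signs and sizes of the coefficients of the two subproblems on one eigenspace. -/
structure CoefBounds (α l T₁ T₂ B d : ℝ) : Prop where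
  S₁_neg : Scoef α l T₁ < 0
  S₂_neg : Scoef α l T₂ < 0
  Q₁_pos : 0 < Qcoef α l T₁
  Q₂_pos : 0 < Qcoef α l T₂
  R_neg : Rcoef α l T₁ T₂ < 0
  Q_div_S_le : |Qcoef α l T₁ / Scoef α l T₁| ≤ B
  ratio_le : |Scoef α l T₂ * Qcoef α l T₁ / (Scoef α l T₁ * Qcoef α l T₂)| ≤ d

/-- Once λT₁^α ≥ X, S is negative and increases from T₁ to T₂, so λQ = 1 - S gives all the signs.
Both quantitative bounds compare quantities scaled by λ, and λ cancels: they do not depend on the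
eigenvalue. -/
lemma coefBounds_of_le {X : ℝ} (hα : 0 < α) (hΓ : Real.Gamma (1 - α) ≠ 0)
    (hneg : ∀ x, X ≤ x → mittagLeffler α 1 (-x) ≤ -(1 / (2 * |Real.Gamma (1 - α)|) * x⁻¹))
    (hinc : ∀ x₁ x₂, X ≤ x₁ → x₁ ≤ x₂ →
      1 / (2 * |Real.Gamma (1 - α)|) * (x₁⁻¹ - x₂⁻¹) ≤
        mittagLeffler α 1 (-x₂) - mittagLeffler α 1 (-x₁))
    (hT₁ : 0 < T₁) (hT : T₁ < T₂) (hl : 0 < l) (hlX : X ≤ l * T₁ ^ α)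
    (hC₁ : IsDecayConst α 1 C₁) (hC₂ : IsDecayConst α (α + 1) C₂) :
    CoefBounds α l T₁ T₂ (2 * |Real.Gamma (1 - α)| * T₁ ^ α * (1 + C₁))
      (dConst α T₁ T₂ C₁ C₂) := by
  have hT₂ : 0 < T₂ := hT₁.trans hT
  set γ := |Real.Gamma (1 - α)| with hγdef
  have hγ : 0 < γ := abs_pos.2 hΓ
  set κ := 1 / (2 * γ) with hκdef
  have hκ : 0 < κ := by positivity
  have hp1 : 0 < T₁ ^ α := by positivity
  have hp2 : 0 < T₂ ^ α := by positivity
  have hp12 : T₁ ^ α < T₂ ^ α := Real.rpow_lt_rpow hT₁.le hT hα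
  have hx1 : 0 < l * T₁ ^ α := by positivity
  have hx2 : 0 < l * T₂ ^ α := by positivity
  have hx12 : l * T₁ ^ α < l * T₂ ^ α := by gcongr
  have n1 : Scoef α l T₁ ≤ -(κ * (l * T₁ ^ α)⁻¹) := hneg _ hlX
  have n2 : Scoef α l T₂ ≤ -(κ * (l * T₂ ^ α)⁻¹) := hneg _ (hlX.trans hx12.le)
  have i12 : κ * ((l * T₁ ^ α)⁻¹ - (l * T₂ ^ α)⁻¹) ≤ Scoef α l T₂ - Scoef α l T₁ :=
    hinc _ _ hlX hx12.le
  have hq1 := mul_Qcoef hα hl hT₁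
  have hq2 := mul_Qcoef hα hl hT₂
  have bS := abs_Scoef_le hl hT₁ hC₁
  have bS' := abs_Scoef_le_const hl hT₁ hC₁
  have bQ := abs_Qcoef_le hl hT₂ hC₂
  have hS1 : Scoef α l T₁ < 0 := n1.trans_lt (by rw [neg_neg_iff_pos]; positivity)
  have hS2 : Scoef α l T₂ < 0 := n2.trans_lt (by rw [neg_neg_iff_pos]; positivity)
  have hS12 : Scoef α l T₁ < Scoef α l T₂ := by
    have := mul_pos hκ (sub_pos.2 (inv_strictAnti₀ hx1 hx12))
    linarith
  set S₁ := Scoef α l T₁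
  set S₂ := Scoef α l T₂
  set Q₁ := Qcoef α l T₁
  set Q₂ := Qcoef α l T₂
  have hQ1 : 0 < Q₁ := pos_of_mul_pos_right (by rw [hq1]; linarith) hl.le
  have hQ2 : 0 < Q₂ := pos_of_mul_pos_right (by rw [hq2]; linarith) hl.le
  -- The products S₁S₂ cancel after substituting λQ = 1 - S.
  have hlR : l * (S₁ * Q₂ - S₂ * Q₁) = S₁ - S₂ := by
    linear_combination S₁ * hq2 - S₂ * hq1
  have hR : S₁ * Q₂ - S₂ * Q₁ < 0 := by nlinarith
  refine ⟨hS1, hS2, hQ1, hQ2, hR, ?_, ?_⟩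
  · rw [abs_div, abs_of_pos hQ1, div_le_iff₀ (abs_pos.2 hS1.ne)]
    rw [abs_of_neg hS1] at bS' ⊢
    -- λQ₁ ≤ 1 + C₁ while -S₁ ≥ κ/(λT₁^α), so the quotient is bounded by (1 + C₁)T₁^α/κ.
    have h1 : l * Q₁ ≤ 1 + C₁ := by linarith
    have h2 : 1 ≤ 2 * γ * (l * T₁ ^ α) * -S₁ := by
      have : 2 * γ * (l * T₁ ^ α) * (κ * (l * T₁ ^ α)⁻¹) = 1 := by
        rw [hκdef]
        field_simp
      nlinarith [mul_le_mul_of_nonneg_left n1 (show 0 ≤ 2 * γ * (l * T₁ ^ α) by positivity)]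
    have h3 : l * Q₁ ≤ l * (2 * γ * T₁ ^ α * (1 + C₁) * -S₁) := by
      calc l * Q₁ ≤ (1 + C₁) * 1 := by linarith
        _ ≤ (1 + C₁) * (2 * γ * (l * T₁ ^ α) * -S₁) := by
          have := hC₁.1
          gcongr
        _ = _ := by ring
    exact le_of_mul_le_mul_left h3 hl
  · unfold dConst
    -- The second entry of the maximum already bounds the ratio; the first is what makes d positive.
    refine le_max_of_le_right ?_
    have hden : S₁ * Q₂ < 0 := mul_neg_of_neg_of_pos hS1 hQ2
    rw [abs_of_nonneg (div_nonneg_of_nonpos (by nlinarith) hden.le), div_le_iff_of_neg hden]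
    set δ := 1 / (2 * C₁ * C₂ * γ) * (1 - T₁ ^ α / T₂ ^ α) with hδ
    have hc1 := hC₁.1
    have hc2 := hC₂.1
    have hδ0 : 0 ≤ δ := by
      have : T₁ ^ α / T₂ ^ α ≤ 1 := (div_le_one hp2).2 hp12.le
      have := sub_nonneg.2 this
      positivity
    -- By `hlR` this is 1 - ρ ≥ δ with denominators cleared.
    have key : l * (δ * (-S₁ * Q₂)) ≤ S₂ - S₁ := by
      have e1 : -S₁ ≤ C₁ / (l * T₁ ^ α) :=
        (neg_le_abs _).trans (bS.trans (by gcongr; linarith))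
      have e2 : l * Q₂ ≤ C₂ := by
        calc l * Q₂ ≤ l * (T₂ ^ α * (C₂ / (1 + l * T₂ ^ α))) := by
              gcongr
              exact (le_abs_self _).trans bQ
          _ = C₂ * (l * T₂ ^ α / (1 + l * T₂ ^ α)) := by ring
          _ ≤ C₂ * 1 := by
              gcongr
              rw [div_le_one (by positivity)]
              linarith
          _ = C₂ := mul_one _
      calc l * (δ * (-S₁ * Q₂)) = δ * (-S₁ * (l * Q₂)) := by ring
        _ ≤ δ * (C₁ / (l * T₁ ^ α) * C₂) := by
            gcongr
        _ = κ * ((l * T₁ ^ α)⁻¹ - (l * T₂ ^ α)⁻¹) := by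
            rw [hδ, hκdef]
            field_simp
        _ ≤ S₂ - S₁ := i12
    have : l * ((1 - δ) * (S₁ * Q₂)) ≤ l * (S₂ * Q₁) := by nlinarith
    exact le_of_mul_le_mul_left this hl

end Coefficients

/-! ### Vectors and series determined by their coefficients in a Hilbert basis. -/

section HilbertBasisCoefficients

variable {E : Type*} [NormedAddCommGroup E] [InnerProductSpace ℝ E] (b : HilbertBasis ℕ ℝ E)

lemma hasSum_of_inner_eq {s : E} {c : ℕ → ℝ} (h : ∀ n, inner ℝ s (b n) = c n) :
    HasSum (fun n => c n • b n) s := by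
  refine (b.hasSum_repr s).congr_fun fun n => ?_
  rw [← h n, b.repr_apply_apply, real_inner_comm]

lemma eq_of_inner_eq {s t : E} (h : ∀ n, inner ℝ s (b n) = inner ℝ t (b n)) : s = t :=
  (hasSum_of_inner_eq b h).unique (hasSum_of_inner_eq b fun _ => rfl)

lemma hasSum_inner_sq (s : E) : HasSum (fun n => inner ℝ s (b n) ^ 2) (‖s‖ ^ 2) := by
  rw [← real_inner_self_eq_norm_sq]
  refine (b.hasSum_inner_mul_inner s s).congr_fun fun n => ?_
  rw [pow_two, real_inner_comm s]

lemma norm_le_of_abs_inner_le {s w : E} {B : ℝ} (hB : 0 ≤ B)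
    (h : ∀ n, |inner ℝ s (b n)| ≤ B * |inner ℝ w (b n)|) : ‖s‖ ≤ B * ‖w‖ := by
  have := hasSum_le (fun n => ?_) (hasSum_inner_sq b s) ((hasSum_inner_sq b w).mul_left (B ^ 2))
  · rw [← mul_pow] at this
    exact le_of_sq_le_sq this (by positivity)
  · rw [← sq_abs, ← sq_abs (inner ℝ w _), ← mul_pow]
    gcongr
    exact h n

/-- A bounded multiplier preserves ℓ². This supplies the sum of a series as a vector, so its
convergence reduces to matching coefficients. -/
lemma exists_inner_eq_mul {m : ℕ → ℝ} {B : ℝ} (hm : ∀ n, |m n| ≤ B) (w : E) :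
    ∃ s : E, ∀ n, inner ℝ s (b n) = m n * inner ℝ w (b n) := by
  have hmem : Memℓp (fun n => m n * inner ℝ w (b n)) 2 := by
    refine memℓp_gen (((hasSum_inner_sq b w).summable.mul_left (B ^ 2)).of_norm_bounded
      fun n => ?_)
    simp only [ENNReal.toReal_ofNat, Real.rpow_ofNat]
    rw [Real.norm_of_nonneg (by positivity), Real.norm_eq_abs, abs_mul, mul_pow,
      sq_abs (inner ℝ w _)]
    gcongr
    exact hm n
  refine ⟨b.repr.symm ⟨_, hmem⟩, fun n => ?_⟩
  rw [real_inner_comm, ← b.repr_apply_apply, LinearIsometryEquiv.apply_symm_apply]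

end HilbertBasisCoefficients

/-! ### Error propagation and geometric convergence. -/

section Iteration

variable {N : ℕ} {Ω : Set (EuclideanSpace ℝ (Fin N))} {α T₁ T₂ B d : ℝ} {lam : ℕ → ℝ}
  {φ : HilbertBasis ℕ ℝ (L2 Ω)} {g₁ g₂ a f : L2 Ω}

lemma inner_tsum_mul {m : ℕ → ℝ} (hm : ∀ n, |m n| ≤ B) (v : L2 Ω) (n : ℕ) :
    inner ℝ (∑' n, (m n * inner ℝ v (φ n)) • φ n) (φ n) = m n * inner ℝ v (φ n) := by
  obtain ⟨s, hs⟩ := exists_inner_eq_mul φ hm v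
  rw [(hasSum_of_inner_eq φ hs).tsum_eq, hs]

lemma inner_directSol {T C C' : ℝ} (hS : ∀ n, |Scoef α (lam n) T| ≤ C)
    (hQ : ∀ n, |Qcoef α (lam n) T| ≤ C') (v w : L2 Ω) (n : ℕ) :
    inner ℝ (directSol α lam φ v w T) (φ n) =
      Scoef α (lam n) T * inner ℝ v (φ n) + Qcoef α (lam n) T * inner ℝ w (φ n) := by
  unfold directSol Sop Qop
  rw [inner_add_left, inner_tsum_mul hS, inner_tsum_mul hQ]

/-- The backward subproblem: its series converges, and the error is that of the source times
`-Q_n(T₁) / S_n(T₁)`. -/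
lemma backward_step (hb : ∀ n, CoefBounds α (lam n) T₁ T₂ B d)
    (hg₁ : ∀ n, inner ℝ g₁ (φ n) =
      Scoef α (lam n) T₁ * inner ℝ a (φ n) + Qcoef α (lam n) T₁ * inner ℝ f (φ n)) (h : L2 Ω) :
    Summable (backwardTerm α lam φ T₁ g₁ h) ∧
      ∀ n, inner ℝ (∑' n, backwardTerm α lam φ T₁ g₁ h n - a) (φ n) =
        -(Qcoef α (lam n) T₁ / Scoef α (lam n) T₁) * inner ℝ (h - f) (φ n) := by
  obtain ⟨s, hs⟩ := exists_inner_eq_mul φ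
    (m := fun n => -(Qcoef α (lam n) T₁ / Scoef α (lam n) T₁)) (B := B)
    (fun n => by rw [abs_neg]; exact (hb n).Q_div_S_le) (h - f)
  -- The individual pieces g/S need not be square summable for arbitrary data; written through the
  -- exact solution, only the bounded multiplier Q/S acts on h - f.
  have hsum : HasSum (backwardTerm α lam φ T₁ g₁ h) (a + s) := by
    refine hasSum_of_inner_eq φ fun n => ?_
    have := (hb n).S₁_neg.ne
    rw [inner_add_left, hs, hg₁, inner_sub_left]
    field_simp
    ring
  refine ⟨hsum.summable, fun n => ?_⟩
  rw [hsum.tsum_eq, add_sub_cancel_left, hs]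

/-- The source subproblem following a backward subproblem: its series converges, and the error is
multiplied by `S_n(T₂) Q_n(T₁) / (S_n(T₁) Q_n(T₂))`. -/
lemma source_step (hb : ∀ n, CoefBounds α (lam n) T₁ T₂ B d)
    (hg₂ : ∀ n, inner ℝ g₂ (φ n) =
      Scoef α (lam n) T₂ * inner ℝ a (φ n) + Qcoef α (lam n) T₂ * inner ℝ f (φ n)) {h v : L2 Ω}
    (hv : ∀ n, inner ℝ (v - a) (φ n) =
        -(Qcoef α (lam n) T₁ / Scoef α (lam n) T₁) * inner ℝ (h - f) (φ n)) :
    Summable (sourceTerm α lam φ T₂ g₂ v) ∧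
      ∀ n, inner ℝ (∑' n, sourceTerm α lam φ T₂ g₂ v n - f) (φ n) =
        Scoef α (lam n) T₂ * Qcoef α (lam n) T₁ / (Scoef α (lam n) T₁ * Qcoef α (lam n) T₂) *
          inner ℝ (h - f) (φ n) := by
  obtain ⟨s, hs⟩ := exists_inner_eq_mul φ (fun n => (hb n).ratio_le) (h - f)
  have hsum : HasSum (sourceTerm α lam φ T₂ g₂ v) (f + s) := by
    refine hasSum_of_inner_eq φ fun n => ?_
    have h1 := (hb n).S₁_neg.ne
    have h2 := (hb n).Q₂_pos.ne'
    have hv' := hv n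
    rw [inner_sub_left, sub_eq_iff_eq_add] at hv'
    rw [inner_add_left, hs, hg₂, hv']
    field_simp
    ring
  refine ⟨hsum.summable, fun n => ?_⟩
  rw [hsum.tsum_eq, add_sub_cancel_left, hs]

/-- Both errors obey the same scalar recursion: the multiplier -Q(T₁)/S(T₁) linking them commutes
with ρ. Norm estimates follow mode by mode. -/
theorem iteration_converges {C₁ C₂ D₁ D₂ : ℝ} (hd : 0 ≤ d)
    (hb : ∀ n, CoefBounds α (lam n) T₁ T₂ B d)
    (hS₁ : ∀ n, |Scoef α (lam n) T₁| ≤ C₁) (hS₂ : ∀ n, |Scoef α (lam n) T₂| ≤ C₂)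
    (hQ₁ : ∀ n, |Qcoef α (lam n) T₁| ≤ D₁) (hQ₂ : ∀ n, |Qcoef α (lam n) T₂| ≤ D₂)
    (hex : IsExactSolution α lam φ T₁ T₂ g₁ g₂ a f) (f₀ : L2 Ω) :
    HasSum (fun n => (1 / Rcoef α (lam n) T₁ T₂ * (Qcoef α (lam n) T₂ * inner ℝ g₁ (φ n) -
      Qcoef α (lam n) T₁ * inner ℝ g₂ (φ n))) • φ n) a ∧
    HasSum (fun n => (1 / Rcoef α (lam n) T₁ T₂ * (Scoef α (lam n) T₁ * inner ℝ g₂ (φ n) -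
      Scoef α (lam n) T₂ * inner ℝ g₁ (φ n))) • φ n) f ∧
    ∀ k : ℕ,
      Summable (backwardTerm α lam φ T₁ g₁ (iterF α lam φ T₁ T₂ g₁ g₂ f₀ k)) ∧
      Summable (sourceTerm α lam φ T₂ g₂ (iterA α lam φ T₁ T₂ g₁ g₂ f₀ k)) ∧
      directSol α lam φ (iterA α lam φ T₁ T₂ g₁ g₂ f₀ k)
        (iterF α lam φ T₁ T₂ g₁ g₂ f₀ k) T₁ = g₁ ∧
      directSol α lam φ (iterA α lam φ T₁ T₂ g₁ g₂ f₀ k)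
        (iterF α lam φ T₁ T₂ g₁ g₂ f₀ (k + 1)) T₂ = g₂ ∧
      ‖iterA α lam φ T₁ T₂ g₁ g₂ f₀ k - a‖ ≤
        d ^ k * ‖iterA α lam φ T₁ T₂ g₁ g₂ f₀ 0 - a‖ ∧
      ‖iterF α lam φ T₁ T₂ g₁ g₂ f₀ k - f‖ ≤ d ^ k * ‖f₀ - f‖ := by
  have hg₁ : ∀ n, inner ℝ g₁ (φ n) =
      Scoef α (lam n) T₁ * inner ℝ a (φ n) + Qcoef α (lam n) T₁ * inner ℝ f (φ n) := fun n => by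
    rw [← hex.1, inner_directSol hS₁ hQ₁]
  have hg₂ : ∀ n, inner ℝ g₂ (φ n) =
      Scoef α (lam n) T₂ * inner ℝ a (φ n) + Qcoef α (lam n) T₂ * inner ℝ f (φ n) := fun n => by
    rw [← hex.2, inner_directSol hS₂ hQ₂]
  set A := iterA α lam φ T₁ T₂ g₁ g₂ f₀ with hA
  set F := iterF α lam φ T₁ T₂ g₁ g₂ f₀ with hF
  have hback : ∀ k, Summable (backwardTerm α lam φ T₁ g₁ (F k)) ∧
      ∀ n, inner ℝ (A k - a) (φ n) =
        -(Qcoef α (lam n) T₁ / Scoef α (lam n) T₁) * inner ℝ (F k - f) (φ n) := fun k =>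
    backward_step hb hg₁ (F k)
  have hsrc : ∀ k, Summable (sourceTerm α lam φ T₂ g₂ (A k)) ∧
      ∀ n, inner ℝ (F (k + 1) - f) (φ n) =
        Scoef α (lam n) T₂ * Qcoef α (lam n) T₁ / (Scoef α (lam n) T₁ * Qcoef α (lam n) T₂) *
          inner ℝ (F k - f) (φ n) := fun k =>
    source_step hb hg₂ (hback k).2
  have hFstep : ∀ k, ‖F (k + 1) - f‖ ≤ d * ‖F k - f‖ := fun k => by
    refine norm_le_of_abs_inner_le φ hd fun n => ?_
    rw [(hsrc k).2, abs_mul]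
    gcongr
    exact (hb n).ratio_le
  have hAstep : ∀ k, ‖A (k + 1) - a‖ ≤ d * ‖A k - a‖ := fun k => by
    refine norm_le_of_abs_inner_le φ hd fun n => ?_
    -- Commuting the two multipliers turns the error in f back into the previous error in a, so the
    -- a-iterates contract with no extra constant.
    rw [(hback (k + 1)).2, (hsrc k).2, mul_left_comm, ← (hback k).2, abs_mul]
    gcongr
    exact (hb n).ratio_le
  have hgeom : ∀ {u : ℕ → ℝ}, (∀ k, u (k + 1) ≤ d * u k) → ∀ k, u k ≤ d ^ k * u 0 := by
    intro u hu k
    induction k with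
    | zero => simp
    | succ k ih =>
      calc u (k + 1) ≤ d * u k := hu k
        _ ≤ d * (d ^ k * u 0) := by gcongr
        _ = d ^ (k + 1) * u 0 := by ring
  refine ⟨hasSum_of_inner_eq φ fun n => ?_, hasSum_of_inner_eq φ fun n => ?_, fun k =>
    ⟨(hback k).1, (hsrc k).1, eq_of_inner_eq φ fun n => ?_, eq_of_inner_eq φ fun n => ?_,
      hgeom (u := fun k => ‖A k - a‖) hAstep k, hgeom (u := fun k => ‖F k - f‖) hFstep k⟩⟩
  · have hR := (hb n).R_neg.ne
    rw [hg₁, hg₂, one_div, eq_inv_mul_iff_mul_eq₀ hR, Rcoef]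
    ring
  · have hR := (hb n).R_neg.ne
    rw [hg₁, hg₂, one_div, eq_inv_mul_iff_mul_eq₀ hR, Rcoef]
    ring
  · have h1 := (hback k).2 n
    have hS := (hb n).S₁_neg.ne
    rw [inner_sub_left, inner_sub_left, sub_eq_iff_eq_add] at h1
    rw [inner_directSol hS₁ hQ₁, hg₁, h1]
    field_simp
    ring
  · have h1 := (hback k).2 n
    have h2 := (hsrc k).2 n
    have hS := (hb n).S₁_neg.ne
    have hQ := (hb n).Q₂_pos.ne'
    rw [inner_sub_left, inner_sub_left, sub_eq_iff_eq_add] at h1 h2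
    rw [inner_directSol hS₂ hQ₂, hg₂, h1, h2]
    field_simp
    ring

end Iteration

end AltRecon

/-! ### Choice of the threshold time and assembly. -/

theorem lemma3p1 (N : ℕ) (hN₁ : 1 ≤ N) (hN₃ : N ≤ 3)
    (Ω : Set (EuclideanSpace ℝ (Fin N))) (hΩo : IsOpen Ω) (hΩc : IsConnected Ω)
    (hΩb : Bornology.IsBounded Ω) (α : ℝ) (hα₁ : 1 < α) (hα₂ : α < 2) :
    -- the constants that enter `d` exist
    (∃ C₁, AltRecon.IsDecayConst α 1 C₁) ∧ (∃ C₂, AltRecon.IsDecayConst α (α + 1) C₂) ∧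
    -- for all sufficiently large `T₁`
    ∃ Tstar : ℝ, 0 < Tstar ∧ ∀ T₁ T₂ : ℝ, Tstar ≤ T₁ → T₁ < T₂ →
      ∀ C₁ C₂ : ℝ, AltRecon.IsDecayConst α 1 C₁ → AltRecon.IsDecayConst α (α + 1) C₂ →
      (0 < AltRecon.dConst α T₁ T₂ C₁ C₂ ∧ AltRecon.dConst α T₁ T₂ C₁ C₂ < 1) ∧
      ∀ (lam : ℕ → ℝ) (φ : HilbertBasis ℕ ℝ (AltRecon.L2 Ω)),
        AltRecon.IsDirichletEigensystem Ω lam φ →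
        -- no denominator vanishes
        (∀ n, AltRecon.Scoef α (lam n) T₁ ≠ 0 ∧ AltRecon.Qcoef α (lam n) T₂ ≠ 0 ∧
          AltRecon.Rcoef α (lam n) T₁ T₂ ≠ 0) ∧
        ∀ p : ℝ, 0 < p → p ≤ 1 → ∀ g₁ g₂ a f f₀ : AltRecon.L2 Ω,
          a ∈ AltRecon.domPow lam φ p → f ∈ AltRecon.domPow lam φ p →
          f₀ ∈ AltRecon.domPow lam φ p →
          AltRecon.IsExactSolution α lam φ T₁ T₂ g₁ g₂ a f →
          -- the exact solution is given by Cramer's rule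
          HasSum (fun n => (1 / AltRecon.Rcoef α (lam n) T₁ T₂ *
            (AltRecon.Qcoef α (lam n) T₂ * inner ℝ g₁ (φ n) -
              AltRecon.Qcoef α (lam n) T₁ * inner ℝ g₂ (φ n))) • φ n) a ∧
          HasSum (fun n => (1 / AltRecon.Rcoef α (lam n) T₁ T₂ *
            (AltRecon.Scoef α (lam n) T₁ * inner ℝ g₂ (φ n) -
              AltRecon.Scoef α (lam n) T₂ * inner ℝ g₁ (φ n))) • φ n) f ∧
          ∀ k : ℕ,
            -- the series defining the iterates converge, and the iterates solve the subproblems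
            Summable (AltRecon.backwardTerm α lam φ T₁ g₁
              (AltRecon.iterF α lam φ T₁ T₂ g₁ g₂ f₀ k)) ∧
            Summable (AltRecon.sourceTerm α lam φ T₂ g₂
              (AltRecon.iterA α lam φ T₁ T₂ g₁ g₂ f₀ k)) ∧
            AltRecon.directSol α lam φ (AltRecon.iterA α lam φ T₁ T₂ g₁ g₂ f₀ k)
              (AltRecon.iterF α lam φ T₁ T₂ g₁ g₂ f₀ k) T₁ = g₁ ∧
            AltRecon.directSol α lam φ (AltRecon.iterA α lam φ T₁ T₂ g₁ g₂ f₀ k)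
              (AltRecon.iterF α lam φ T₁ T₂ g₁ g₂ f₀ (k + 1)) T₂ = g₂ ∧
            -- geometric convergence
            ‖AltRecon.iterA α lam φ T₁ T₂ g₁ g₂ f₀ k - a‖ ≤
              AltRecon.dConst α T₁ T₂ C₁ C₂ ^ k *
                ‖AltRecon.iterA α lam φ T₁ T₂ g₁ g₂ f₀ 0 - a‖ ∧
            ‖AltRecon.iterF α lam φ T₁ T₂ g₁ g₂ f₀ k - f‖ ≤
              AltRecon.dConst α T₁ T₂ C₁ C₂ ^ k * ‖f₀ - f‖ := by
  have hα : 0 < α := by linarith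
  have hΓ := (AltRecon.Gamma_one_sub_neg hα₁ hα₂).ne
  refine ⟨AltRecon.exists_isDecayConst_one hα₁ hα₂,
    AltRecon.exists_isDecayConst_add_one hα₁ hα₂, ?_⟩
  obtain ⟨X, hX, hneg, hinc⟩ := AltRecon.exists_mittagLeffler_one_neg_lower hα₁ hα₂
  obtain ⟨M, hM0, hM⟩ := hΩb.exists_pos_norm_le
  -- As λ_n ≥ 1/(4M²), this threshold forces λ_n T₁^α ≥ X for every n. M depends only on Ω and X
  -- only on α.
  refine ⟨(4 * M ^ 2 * X) ^ α⁻¹, by positivity, fun T₁ T₂ hT₁' hT C₁ C₂ hC₁ hC₂ => ?_⟩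
  have hT₁ : 0 < T₁ := lt_of_lt_of_le (by positivity) hT₁'
  have hT₂ : 0 < T₂ := hT₁.trans hT
  have hd := AltRecon.dConst_pos (α := α) (C₁ := C₁) (C₂ := C₂) hT₁ hT₂
  refine ⟨⟨hd, AltRecon.dConst_lt_one hα hΓ hT₁ hT hC₁.1 hC₂.1⟩, fun lam φ hφ => ?_⟩
  -- N ≥ 1 supplies the coordinate direction used in Poincaré's inequality.
  have hlam : ∀ n, 1 ≤ 4 * M ^ 2 * lam n := fun n =>
    (hφ n).one_le_mul ⟨0, hN₁⟩ hM (φ.orthonormal.1 n)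
  have hlpos : ∀ n, 0 < lam n := fun n =>
    pos_of_mul_pos_right (lt_of_lt_of_le one_pos (hlam n)) (by positivity)
  have hTα : 4 * M ^ 2 * X ≤ T₁ ^ α := by
    have h := Real.rpow_le_rpow (by positivity) hT₁' hα.le
    rwa [Real.rpow_inv_rpow (by positivity) hα.ne'] at h
  have hX₁ : ∀ n, X ≤ lam n * T₁ ^ α := fun n => by
    calc X ≤ 4 * M ^ 2 * lam n * X := le_mul_of_one_le_left hX.le (hlam n)
      _ = lam n * (4 * M ^ 2 * X) := by ring
      _ ≤ lam n * T₁ ^ α := by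
        have := hlpos n
        gcongr
  have hb := fun n =>
    AltRecon.coefBounds_of_le hα hΓ hneg hinc hT₁ hT (hlpos n) (hX₁ n) hC₁ hC₂
  refine ⟨fun n => ⟨(hb n).S₁_neg.ne, (hb n).Q₂_pos.ne', (hb n).R_neg.ne⟩, ?_⟩
  intro p _ _ g₁ g₂ a f f₀ _ _ _ hex
  exact AltRecon.iteration_converges hd.le hb
    (fun n => AltRecon.abs_Scoef_le_const (hlpos n) hT₁ hC₁)
    (fun n => AltRecon.abs_Scoef_le_const (hlpos n) hT₂ hC₁)
    (fun n => AltRecon.abs_Qcoef_le_const (hlpos n) hT₁ hC₂)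
    (fun n => AltRecon.abs_Qcoef_le_const (hlpos n) hT₂ hC₂) hex f₀
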